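/- Let $\phi:\mathcal X\to\mathcal H$ be a (strongly measurable) feature map from a measurable space into a real Hilbert space, with kernel $k(x,x')=\langle\phi(x),\phi(x')\rangle$, and let $\mathcal D$ be a probability distribution on $\mathcal X\times\mathbb R$. Let $N\ge 1$ and let $(x_1,y_1),\dots,(x_N,y_N)$ be drawn i.i.d. from $\mathcal D$; write $y=(y_1,\dots,y_N)^\top$ and $K=(k(x_i,x_j))_{i,j=1}^N$. Assume that the kernel is normalized so that $\operatorname{Tr}(K)=N$ almost surely. Let $$w=\sqrt{\frac{\operatorname{Tr}(K)}{N}}\;\sum_{i=1}^N\,[K^{-1}y]_i\,\phi(x_i)$$ be the kernel regression solution (defined when $K$ is invertible). Let $\ell:\mathbb R\times\mathbb R\to[0,b]$ be a measurable loss that is $L$-Lipschitz in its first argument (the prediction), uniformly in the second (the target). Then for every $\delta>0$, with probability at least $1-\delta$ over the training sample, if $K$ is invertible then $$\mathbb E_{(x,y')\sim\mathcal D}\big[\ell(\langle w,\phi(x)\rangle,y')\big]-\frac1N\sum_{i=1}^N\ell(\langle w,\phi(x_i)\rangle,y_i)\;\le\;\frac{2\sqrt2\,L+3b}{\sqrt2}\cdot\frac{\sqrt{\operatorname{Tr}(K)\,y^\top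 K^{-1}y}}{N}+3b\sqrt{\frac{\log\!\big(2/(\delta(e-1))\big)}{2N}} .$$ In particular, if $K$ is almost surely invertible, the inequality itself holds with probability at least $1-\delta$. -/

import Mathlib

open MeasureTheory
open scoped NNReal Matrix

noncomputable section

/-- The kernel matrix `K i j = ⟪φ (x i), φ (x j)⟫` of a training set `S i = (x i, y i)`,
for the kernel `k x x' = ⟪φ x, φ x'⟫` with feature map `φ` into a Hilbert space. -/
def kernelMatrix {𝒳 H : Type*} [NormedAddCommGroup H] [InnerProductSpace ℝ H]
    (φ : 𝒳 → H) {N : ℕ} (S : Fin N → 𝒳 × ℝ) : Matrix (Fin N) (Fin N) ℝ :=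
  Matrix.gram ℝ fun i => φ (S i).1

/-- The vector of targets of a training set. -/
def targets {𝒳 : Type*} {N : ℕ} (S : Fin N → 𝒳 × ℝ) : Fin N → ℝ :=
  fun i => (S i).2

/-- The trace-normalized kernel regression solution
`w = √(Tr K / N) ∑ i, (K⁻¹ y) i φ (x i)`. -/
def kernelSolution {𝒳 H : Type*} [NormedAddCommGroup H] [InnerProductSpace ℝ H]
    (φ : 𝒳 → H) {N : ℕ} (S : Fin N → 𝒳 × ℝ) : H :=
  √((kernelMatrix φ S).trace / N) •
    ∑ i, ((kernelMatrix φ S)⁻¹ *ᵥ targets S) i • φ (S i).1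

/-- The population risk of the linear predictor `x ↦ ⟪w, φ x⟫`. -/
def populationRisk {𝒳 H : Type*} [MeasurableSpace 𝒳] [NormedAddCommGroup H]
    [InnerProductSpace ℝ H] (D : Measure (𝒳 × ℝ)) (φ : 𝒳 → H) (ℓ : ℝ → ℝ → ℝ) (w : H) : ℝ :=
  ∫ z, ℓ (inner ℝ w (φ z.1)) z.2 ∂D

/-- The empirical risk of the linear predictor `x ↦ ⟪w, φ x⟫` on a training set. -/
def empiricalRisk {𝒳 H : Type*} [NormedAddCommGroup H] [InnerProductSpace ℝ H]
    (φ : 𝒳 → H) (ℓ : ℝ → ℝ → ℝ) {N : ℕ} (S : Fin N → 𝒳 × ℝ) (w : H) : ℝ :=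
  (1 / (N : ℝ)) * ∑ i, ℓ (inner ℝ w (φ (S i).1)) (S i).2

end

/-! With `Tr K = N` and `K` invertible, the solution `w` satisfies `‖w‖² = yᵀK⁻¹y`, so it suffices
to show, uniformly over linear predictors, that `N (risk - empirical risk) ≤ 2 √N L‖w‖ + s b √N`
with `s = 3 √(Λ/2)`, outside an event of probability at most `δ = 2/(e-1) · exp(-2s²/9)`. The extra
`3b/√2` in the stated coefficient is not needed.

The usual symmetrization already spends the whole constant `2` in front of `√N L‖w‖`. Here the
deviation of `N` points is compared with a Rademacher sum over `2N` points, which costs `√2/γ`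
instead, where `γ` = `symmetrizationFactor` tends to `1` (`integral_ciSup_le_integral_signs`,
`le_symmetrizationFactor`). The gap between `√2` and `2` pays for uniformity in `‖w‖`:

Small norms (`L‖w‖ ≤ 3b`) are treated in one stroke. The penalty `2√N L‖w‖` is subtracted inside the
supremum, so that after contraction only the excess of `‖∑ σᵢ φ(xᵢ)‖` over `2γ√N` matters, and a
fourth moment bounds it. The mean is then at most `0.68 b√N`.

Larger norms are cut into shells of width `b/2`. There the first moment gives `1.51` in place of
`2`, and the slack, growing with the norm, makes the failure probabilities summable. Norms with
`2L‖w‖ ≥ √N b` are trivial because the loss is at most `b`.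

McDiarmid's inequality gives concentration around each mean. Suprema are taken over finite classes
and extended by monotone limits and density to the separable span of the features. -/

/-! ### Product measures and McDiarmid's inequality -/

/-- Selecting coordinates along an injection maps i.i.d. samples to i.i.d. samples. -/
theorem measurePreserving_comp_injective {Z I J : Type*} [MeasurableSpace Z] [Fintype I]
    [Fintype J] (D : Measure Z) [IsProbabilityMeasure D] {e : J → I}
    (he : Function.Injective e) :
    MeasurePreserving (fun (y : I → Z) (j : J) => y (e j))
      (Measure.pi fun _ : I => D) (Measure.pi fun _ : J => D) := by
  classical
  have hm : Measurable (fun (y : I → Z) (j : J) => y (e j)) :=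
    measurable_pi_lambda _ fun j => measurable_pi_apply _
  refine ⟨hm, ?_⟩
  symm
  refine Measure.pi_eq fun s hs => ?_
  rw [Measure.map_apply hm (MeasurableSet.univ_pi hs)]
  have : (fun (y : I → Z) (j : J) => y (e j)) ⁻¹' (Set.univ.pi s) =
      Set.univ.pi fun i => ⋂ j, ⋂ (_ : e j = i), s j := by
    ext y
    simp only [Set.mem_preimage, Set.mem_pi, Set.mem_univ, true_implies, Set.mem_iInter]
    exact ⟨fun h i j hj => hj ▸ h j, fun h j => h _ j rfl⟩
  rw [this, Measure.pi_pi]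
  rw [← Finset.prod_subset (Finset.subset_univ (Finset.univ.image e)),
    Finset.prod_image fun a _ b _ h => he h]
  · refine Finset.prod_congr rfl fun j _ => ?_
    congr 1
    ext z
    simp only [Set.mem_iInter]
    exact ⟨fun h => h j rfl, fun h j' hj' => he hj' ▸ h⟩
  · intro i _ hi
    have : (⋂ j, ⋂ (_ : e j = i), s j) = Set.univ := by
      refine Set.eq_univ_of_forall fun z => ?_
      simp only [Set.mem_iInter]
      intro j hj
      exact absurd (Finset.mem_image.2 ⟨j, Finset.mem_univ _, hj⟩) hi
    rw [this, measure_univ]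

theorem integrable_of_measurable_of_abs_le {Ω : Type*} [MeasurableSpace Ω] {μ : Measure Ω}
    [IsFiniteMeasure μ] {g : Ω → ℝ} (hg : Measurable g) {C : ℝ} (h : ∀ x, |g x| ≤ C) :
    Integrable g μ :=
  Integrable.of_bound hg.aestronglyMeasurable C (Filter.Eventually.of_forall h)

/-- Hoeffding's lemma, with the interval `[inf g, inf g + c]` recovered from the oscillation. -/
theorem integral_exp_mul_sub_integral_le {Ω : Type*} [MeasurableSpace Ω] (μ : Measure Ω)
    [IsProbabilityMeasure μ] {g : Ω → ℝ} (hg : Measurable g) {c : ℝ}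
    (hc : ∀ x y, g x - g y ≤ c) (t : ℝ) :
    ∫ x, Real.exp (t * (g x - ∫ y, g y ∂μ)) ∂μ ≤ Real.exp (c ^ 2 * t ^ 2 / 8) := by
  have : Nonempty Ω := μ.nonempty_of_neZero
  obtain ⟨x₀⟩ := this
  have hbdd : BddBelow (Set.range g) := ⟨g x₀ - c, by
    rintro _ ⟨y, rfl⟩; linarith [hc x₀ y]⟩
  have hmem : ∀ x, g x ∈ Set.Icc (⨅ y, g y) ((⨅ y, g y) + c) := by
    intro x
    refine ⟨ciInf_le hbdd x, ?_⟩
    have : Nonempty Ω := ⟨x⟩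
    have : g x - c ≤ ⨅ y, g y := le_ciInf fun y => by linarith [hc x y]
    linarith
  have h := ProbabilityTheory.hasSubgaussianMGF_of_mem_Icc (μ := μ) hg.aemeasurable
    (Filter.Eventually.of_forall hmem)
  have h2 := h.mgf_le t
  refine h2.trans (Real.exp_le_exp.2 (le_of_eq ?_))
  push_cast
  simp only [add_sub_cancel_left, Real.norm_eq_abs, div_pow, sq_abs]
  ring

/-- **McDiarmid's inequality**, exponential moment form. -/
theorem integral_exp_mul_sub_integral_le_of_bounded_differences {Z : Type*} [MeasurableSpace Z]
    (D : Measure Z) [IsProbabilityMeasure D] {c C : ℝ} (t : ℝ) (n : ℕ) (g : (Fin n → Z) → ℝ)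
    (hg : Measurable g) (hC : ∀ x, |g x| ≤ C)
    (hc : ∀ (i : Fin n) (x y : Fin n → Z), (∀ j ≠ i, x j = y j) → g x - g y ≤ c) :
    ∫ S, Real.exp (t * (g S - ∫ S', g S' ∂(Measure.pi fun _ => D))) ∂(Measure.pi fun _ => D) ≤
      Real.exp (n * (c ^ 2 * t ^ 2 / 8)) := by
  induction n with
  | zero =>
    have : ∀ S : Fin 0 → Z, g S - ∫ S', g S' ∂(Measure.pi fun _ => D) = 0 := by
      intro S
      have h : ∀ S', g S' = g S := fun S' => congrArg g (Subsingleton.elim _ _)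
      simp [h]
    simp [this]
  | succ n ih =>
    have hmp := (measurePreserving_piFinSuccAbove (fun _ : Fin (n + 1) => D) 0).symm
    set m := (∫ S', g S' ∂(Measure.pi fun _ : Fin (n + 1) => D)) with hm
    have hcons : ∀ p : Z × (Fin n → Z),
        (MeasurableEquiv.piFinSuccAbove (fun _ => Z) (0 : Fin (n + 1))).symm p =
          Fin.cons p.1 p.2 := by
      intro p; simp [MeasurableEquiv.piFinSuccAbove, Fin.insertNthEquiv]
    have hmeas : Measurable fun p : Z × (Fin n → Z) => g (Fin.cons p.1 p.2) := by
      have : (fun p : Z × (Fin n → Z) => g (Fin.cons p.1 p.2)) =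
          g ∘ (MeasurableEquiv.piFinSuccAbove (fun _ => Z) (0 : Fin (n + 1))).symm := by
        ext p; simp only [Function.comp_apply, hcons]
      rw [this]
      exact hg.comp hmp.measurable
    -- Integrating out coordinate `0` keeps the bounds and bounded differences, so induction applies
    -- to `h`; the fluctuation of `g` around `h` in that coordinate is handled by Hoeffding's lemma.
    set h : (Fin n → Z) → ℝ := fun x => ∫ z, g (Fin.cons z x) ∂D with hh
    have hmeas' : ∀ x, Measurable fun z => g (Fin.cons z x) := fun x =>
      hmeas.comp (measurable_id.prodMk measurable_const)
    have hint : ∀ x, Integrable (fun z => g (Fin.cons z x)) D := fun x =>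
      integrable_of_measurable_of_abs_le (hmeas' x) fun z => hC _
    have hhm : Measurable h :=
      hmeas.stronglyMeasurable.integral_prod_left'.measurable
    have hhC : ∀ x, |h x| ≤ C := by
      intro x
      have := norm_integral_le_of_norm_le_const (μ := D) (f := fun z => g (Fin.cons z x))
        (C := C) (Filter.Eventually.of_forall fun z => hC _)
      simpa using this
    have hhc : ∀ (i : Fin n) (x y : Fin n → Z), (∀ j ≠ i, x j = y j) → h x - h y ≤ c := by
      intro i x y hxy
      rw [hh, ← integral_sub (hint x) (hint y)]
      calc _ ≤ ∫ z, c ∂D := integral_mono ((hint x).sub (hint y)) (integrable_const _) fun z => by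
            refine hc i.succ _ _ fun j hj => ?_
            refine Fin.cases (by simp) (fun j hj => ?_) j hj
            simpa using hxy j (fun e => hj (by rw [e]))
        _ = c := by simp
    have hIH := ih h hhm hhC hhc
    have hgint : Integrable (fun p : Z × (Fin n → Z) => g (Fin.cons p.1 p.2))
        (D.prod (Measure.pi fun _ => D)) :=
      integrable_of_measurable_of_abs_le hmeas fun p => hC _
    have hmh : m = ∫ x, h x ∂(Measure.pi fun _ => D) := by
      rw [hm, ← hmp.integral_comp']
      simp only [hcons]
      rw [integral_prod_symm _ hgint]
    have hem : Measurable fun p : Z × (Fin n → Z) => Real.exp (t * (g (Fin.cons p.1 p.2) - m)) :=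
      Real.measurable_exp.comp (measurable_const.mul (hmeas.sub_const _))
    have hexpC : ∀ (a : ℝ), |a| ≤ C → |Real.exp (t * (a - m))| ≤ Real.exp (|t| * (C + |m|)) := by
      intro a ha
      rw [Real.abs_exp, Real.exp_le_exp]
      refine (le_abs_self _).trans ?_
      rw [abs_mul]
      gcongr
      exact (abs_sub _ _).trans (by gcongr)
    have heint : Integrable (fun p : Z × (Fin n → Z) => Real.exp (t * (g (Fin.cons p.1 p.2) - m)))
        (D.prod (Measure.pi fun _ => D)) :=
      integrable_of_measurable_of_abs_le hem fun p => hexpC _ (hC _)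
    have key : ∀ x, ∫ z, Real.exp (t * (g (Fin.cons z x) - m)) ∂D ≤
        Real.exp (c ^ 2 * t ^ 2 / 8) * Real.exp (t * (h x - m)) := by
      intro x
      have h1 := integral_exp_mul_sub_integral_le D (hmeas' x) (c := c) (fun z z' => by
        refine hc 0 _ _ fun j hj => ?_
        refine Fin.cases (fun hj => absurd rfl hj) (fun j _ => by simp) j hj) t
      calc _ = ∫ z, Real.exp (t * (g (Fin.cons z x) - h x)) * Real.exp (t * (h x - m)) ∂D := by
            congr 1; ext z; rw [← Real.exp_add]; ring_nf
        _ = (∫ z, Real.exp (t * (g (Fin.cons z x) - h x)) ∂D) * Real.exp (t * (h x - m)) :=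
            integral_mul_const _ _
        _ ≤ _ := by gcongr
    calc _ = ∫ p, Real.exp (t * (g (Fin.cons p.1 p.2) - m)) ∂(D.prod (Measure.pi fun _ => D)) := by
          rw [← hmp.integral_comp']
          simp only [hcons]
      _ = ∫ x, ∫ z, Real.exp (t * (g (Fin.cons z x) - m)) ∂D ∂(Measure.pi fun _ => D) :=
          integral_prod_symm _ heint
      _ ≤ ∫ x, Real.exp (c ^ 2 * t ^ 2 / 8) * Real.exp (t * (h x - m))
            ∂(Measure.pi fun _ => D) := by
          refine integral_mono heint.integral_prod_right ?_ key
          refine Integrable.const_mul ?_ _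
          exact integrable_of_measurable_of_abs_le
            (Real.measurable_exp.comp (measurable_const.mul (hhm.sub_const _)))
            fun x => hexpC _ (hhC _)
      _ = Real.exp (c ^ 2 * t ^ 2 / 8) * ∫ x, Real.exp (t * (h x - m))
            ∂(Measure.pi fun _ => D) := integral_const_mul _ _
      _ ≤ Real.exp (c ^ 2 * t ^ 2 / 8) * Real.exp (n * (c ^ 2 * t ^ 2 / 8)) := by
          rw [hmh]; gcongr
      _ = _ := by rw [← Real.exp_add]; push_cast; ring_nf

/-- **McDiarmid's inequality** for functions of `n` i.i.d. variables. -/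
theorem measureReal_le_exp_of_bounded_differences {Z : Type*} [MeasurableSpace Z]
    (D : Measure Z) [IsProbabilityMeasure D] {c C : ℝ} (n : ℕ) (hn : 0 < n) (hc0 : 0 < c)
    (g : (Fin n → Z) → ℝ) (hg : Measurable g) (hC : ∀ x, |g x| ≤ C)
    (hc : ∀ (i : Fin n) (x y : Fin n → Z), (∀ j ≠ i, x j = y j) → g x - g y ≤ c)
    {m ε : ℝ} (hm : ∫ S, g S ∂(Measure.pi fun _ => D) ≤ m) (hε : 0 ≤ ε) :
    (Measure.pi fun _ => D).real {S | m + ε ≤ g S} ≤ Real.exp (-2 * ε ^ 2 / (n * c ^ 2)) := by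
  set μ : Measure (Fin n → Z) := Measure.pi fun _ => D
  set e := ∫ S, g S ∂μ
  have hn' : (0 : ℝ) < n := by exact_mod_cast hn
  -- Minimizer of the Chernoff exponent `-tε + n c² t² / 8`.
  set t := 4 * ε / (n * c ^ 2) with ht
  have ht0 : 0 ≤ t := by positivity
  have hint : Integrable (fun S => Real.exp (t * (g S - e))) μ := by
    refine integrable_of_measurable_of_abs_le (C := Real.exp (t * (C - e)))
      (Real.measurable_exp.comp (measurable_const.mul (hg.sub_const _))) fun x => ?_
    rw [Real.abs_exp, Real.exp_le_exp]
    gcongr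
    exact (le_abs_self _).trans (hC x)
  have h1 := ProbabilityTheory.measure_ge_le_exp_mul_mgf (μ := μ) (X := fun S => g S - e) ε ht0 hint
  have h2 := integral_exp_mul_sub_integral_le_of_bounded_differences D t n g hg hC hc
  have hsub : μ.real {S | m + ε ≤ g S} ≤ μ.real {S | ε ≤ g S - e} :=
    measureReal_mono fun S (hS : m + ε ≤ g S) => by
      show ε ≤ g S - e
      linarith
  refine hsub.trans (h1.trans ?_)
  calc _ ≤ Real.exp (-t * ε) * Real.exp (n * (c ^ 2 * t ^ 2 / 8)) := by
        gcongr; exact h2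
    _ = _ := by
        rw [← Real.exp_add, ht]
        congr 1
        field_simp
        ring

/-! ### Random signs and the contraction principle -/

/-- Flip the `i`-th sign. -/
def flipSign {J : Type*} [DecidableEq J] (i : J) (σ : J → ℤˣ) : J → ℤˣ :=
  Function.update σ i (-σ i)

theorem flipSign_self {J : Type*} [DecidableEq J] (i : J) (σ : J → ℤˣ) :
    flipSign i σ i = -σ i := by simp [flipSign]

theorem flipSign_of_ne {J : Type*} [DecidableEq J] {i j : J} (h : j ≠ i) (σ : J → ℤˣ) :
    flipSign i σ j = σ j := by simp [flipSign, h]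

theorem flipSign_involutive {J : Type*} [DecidableEq J] (i : J) :
    Function.Involutive (flipSign i : (J → ℤˣ) → J → ℤˣ) := by
  intro σ
  ext j
  by_cases h : j = i
  · subst h; simp [flipSign_self]
  · simp [flipSign_of_ne h]

theorem sum_comp_flipSign {J : Type*} [DecidableEq J] [Fintype J] (i : J)
    (g : (J → ℤˣ) → ℝ) : ∑ σ, g (flipSign i σ) = ∑ σ, g σ :=
  Equiv.sum_comp (flipSign_involutive i).toPerm g

/-- Averaging over the `i`-th sign alone: flipping permutes the sign vectors, so they may be
compared in pairs. -/
theorem sum_le_sum_of_add_flipSign_le {J : Type*} [DecidableEq J] [Fintype J] (i : J)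
    {g h : (J → ℤˣ) → ℝ} (hgh : ∀ σ, g σ + g (flipSign i σ) ≤ h σ + h (flipSign i σ)) :
    ∑ σ, g σ ≤ ∑ σ, h σ := by
  have := Finset.sum_le_sum fun σ (_ : σ ∈ Finset.univ) => hgh σ
  rw [Finset.sum_add_distrib, Finset.sum_add_distrib, sum_comp_flipSign, sum_comp_flipSign] at this
  linarith

theorem Int.units_cast_eq_or (s : ℤˣ) : ((s : ℤ) : ℝ) = 1 ∨ ((s : ℤ) : ℝ) = -1 := by
  rcases Int.units_eq_one_or s with h | h <;> simp [h]

/-- One sign of the contraction principle. For a pair `t, t'`, the difference `v t - v t'` is at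
most `±(u t - u t')`; a minus sign is absorbed by exchanging the roles of `t` and `t'`. -/
theorem ciSup_add_ciSup_le_of_abs_sub_le {T : Type*} [Finite T] [Nonempty T]
    (A v u : T → ℝ) (h : ∀ t t', |v t - v t'| ≤ |u t - u t'|) :
    (⨆ t, (A t + v t)) + (⨆ t, (A t - v t)) ≤ (⨆ t, (A t + u t)) + (⨆ t, (A t - u t)) := by
  have hb : ∀ g : T → ℝ, BddAbove (Set.range g) := fun g => (Set.finite_range g).bddAbove
  refine ciSup_add_ciSup_le fun t t' => ?_
  have h1 := (le_abs_self _).trans (h t t')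
  rcases abs_cases (u t - u t') with ⟨h2, _⟩ | ⟨h2, _⟩
  · have := le_ciSup (hb fun t => A t + u t) t
    have := le_ciSup (hb fun t => A t - u t) t'
    linarith
  · have := le_ciSup (hb fun t => A t + u t) t'
    have := le_ciSup (hb fun t => A t - u t) t
    linarith

/-- **Contraction principle** for Rademacher averages with an arbitrary offset. -/
theorem sum_ciSup_le_of_abs_sub_le {J T : Type*} [Fintype J] [DecidableEq J] [Finite T]
    [Nonempty T] (A : T → ℝ) (v u : J → T → ℝ)
    (h : ∀ i t t', |v i t - v i t'| ≤ |u i t - u i t'|) :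
    ∑ σ : J → ℤˣ, (⨆ t, (A t + ∑ i, ((σ i : ℤ) : ℝ) * v i t)) ≤
      ∑ σ : J → ℤˣ, (⨆ t, (A t + ∑ i, ((σ i : ℤ) : ℝ) * u i t)) := by
  -- Exchange `v` for `u` one coordinate at a time; the other coordinates join the offset.
  suffices hs : ∀ s : Finset J, ∑ σ : J → ℤˣ, (⨆ t, (A t + ∑ i, ((σ i : ℤ) : ℝ) * v i t)) ≤
      ∑ σ : J → ℤˣ, (⨆ t, (A t + ∑ i, ((σ i : ℤ) : ℝ) * (if i ∈ s then u i t else v i t))) by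
    simpa using hs Finset.univ
  intro s
  induction s using Finset.induction_on with
  | empty => simp
  | insert i s hi ih =>
    refine ih.trans (sum_le_sum_of_add_flipSign_le i fun σ => ?_)
    have key : ∀ (σ : J → ℤˣ) (s : Finset J) (t : T),
        A t + ∑ j, ((σ j : ℤ) : ℝ) * (if j ∈ s then u j t else v j t) =
        (A t + ∑ j ∈ Finset.univ.erase i, ((σ j : ℤ) : ℝ) * (if j ∈ s then u j t else v j t)) +
          ((σ i : ℤ) : ℝ) * (if i ∈ s then u i t else v i t) := by
      intro σ s t
      rw [← Finset.sum_erase_add _ _ (Finset.mem_univ i), add_assoc]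
    have key2 : ∀ (σ : J → ℤˣ) (t : T),
        ∑ j ∈ Finset.univ.erase i, ((flipSign i σ j : ℤ) : ℝ) *
          (if j ∈ s then u j t else v j t) =
        ∑ j ∈ Finset.univ.erase i, ((σ j : ℤ) : ℝ) * (if j ∈ s then u j t else v j t) := by
      intro σ t
      refine Finset.sum_congr rfl fun j hj => ?_
      rw [flipSign_of_ne (Finset.ne_of_mem_erase hj)]
    have key3 : ∀ (σ : J → ℤˣ) (t : T),
        ∑ j ∈ Finset.univ.erase i, ((σ j : ℤ) : ℝ) *
          (if j ∈ insert i s then u j t else v j t) =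
        ∑ j ∈ Finset.univ.erase i, ((σ j : ℤ) : ℝ) * (if j ∈ s then u j t else v j t) := by
      intro σ t
      refine Finset.sum_congr rfl fun j hj => ?_
      simp [Finset.mem_insert, Finset.ne_of_mem_erase hj]
    simp only [key, key3, key2, flipSign_self, hi, if_false, Finset.mem_insert_self, if_true,
      Units.val_neg, Int.cast_neg, neg_mul, ← sub_eq_add_neg]
    refine ciSup_add_ciSup_le_of_abs_sub_le _ _ _ fun t t' => ?_
    rw [← mul_sub, ← mul_sub, abs_mul, abs_mul]
    exact mul_le_mul_of_nonneg_left (h i t t') (abs_nonneg _)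

theorem sum_flipSign_eq_of_notMem {J E : Type*} [DecidableEq J] [NormedAddCommGroup E]
    [InnerProductSpace ℝ E] (z : J → E) {i : J} {s : Finset J} (hi : i ∉ s) (σ : J → ℤˣ) :
    ∑ j ∈ s, ((flipSign i σ j : ℤ) : ℝ) • z j = ∑ j ∈ s, ((σ j : ℤ) : ℝ) • z j := by
  refine Finset.sum_congr rfl fun j hj => ?_
  rw [flipSign_of_ne (ne_of_mem_of_not_mem hj hi)]

/-! ### Moments of Rademacher sums in a Hilbert space -/

section Moments

variable {J E : Type*} [Fintype J] [DecidableEq J] [NormedAddCommGroup E] [InnerProductSpace ℝ E]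

theorem norm_sq_add_norm_sq_sign (s : ℤˣ) (x z : E) :
    ‖((s : ℤ) : ℝ) • z + x‖ ^ 2 + ‖-(((s : ℤ) : ℝ) • z) + x‖ ^ 2 = 2 * (‖x‖ ^ 2 + ‖z‖ ^ 2) := by
  have hs : ‖((s : ℤ) : ℝ) • z‖ ^ 2 = ‖z‖ ^ 2 := by
    rcases Int.units_cast_eq_or s with h | h <;> simp [h]
  rw [norm_add_sq_real, norm_add_sq_real, inner_neg_left, norm_neg, hs]
  ring

theorem norm_pow_four_add_sign_le (s : ℤˣ) (x z : E) :
    ‖((s : ℤ) : ℝ) • z + x‖ ^ 4 + ‖-(((s : ℤ) : ℝ) • z) + x‖ ^ 4 ≤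
      2 * (‖x‖ ^ 4 + 6 * ‖x‖ ^ 2 * ‖z‖ ^ 2 + ‖z‖ ^ 4) := by
  have hs : ‖((s : ℤ) : ℝ) • z‖ ^ 2 = ‖z‖ ^ 2 := by
    rcases Int.units_cast_eq_or s with h | h <;> simp [h]
  have hcs : (inner ℝ (((s : ℤ) : ℝ) • z) x) ^ 2 ≤ ‖z‖ ^ 2 * ‖x‖ ^ 2 := by
    rw [← hs, ← mul_pow]
    exact sq_le_sq' (neg_le_of_abs_le (abs_real_inner_le_norm _ _)) (real_inner_le_norm _ _)
  have e : ∀ y : E, ‖y‖ ^ 4 = (‖y‖ ^ 2) ^ 2 := fun y => by ring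
  rw [e, e (-(((s : ℤ) : ℝ) • z) + x), norm_add_sq_real, norm_add_sq_real, inner_neg_left,
    norm_neg, hs]
  nlinarith [hcs]

theorem sum_norm_sum_sq (z : J → E) (s : Finset J) :
    ∑ σ : J → ℤˣ, ‖∑ i ∈ s, ((σ i : ℤ) : ℝ) • z i‖ ^ 2 =
      ∑ _σ : J → ℤˣ, ∑ i ∈ s, ‖z i‖ ^ 2 := by
  induction s using Finset.induction_on with
  | empty => simp
  | insert i s hi ih =>
    have h : ∀ σ : J → ℤˣ,
        ‖∑ j ∈ insert i s, ((σ j : ℤ) : ℝ) • z j‖ ^ 2 +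
        ‖∑ j ∈ insert i s, ((flipSign i σ j : ℤ) : ℝ) • z j‖ ^ 2 =
        2 * (‖∑ j ∈ s, ((σ j : ℤ) : ℝ) • z j‖ ^ 2 + ‖z i‖ ^ 2) := by
      intro σ
      rw [Finset.sum_insert hi, Finset.sum_insert hi, sum_flipSign_eq_of_notMem z hi,
        flipSign_self]
      simp only [Units.val_neg, Int.cast_neg, neg_smul]
      exact norm_sq_add_norm_sq_sign _ _ _
    have h2 := Finset.sum_congr (rfl : (Finset.univ : Finset (J → ℤˣ)) = _) fun σ _ => h σ
    rw [Finset.sum_add_distrib, sum_comp_flipSign i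
      (fun σ => ‖∑ j ∈ insert i s, ((σ j : ℤ) : ℝ) • z j‖ ^ 2), ← Finset.mul_sum,
      Finset.sum_add_distrib, ih, ← Finset.sum_add_distrib] at h2
    simp only [Finset.sum_insert hi]
    simp only [Finset.sum_insert hi] at h2
    simp only [add_comm (‖z i‖ ^ 2)]
    rw [Finset.sum_add_distrib] at h2 ⊢
    linarith

/-- Adding a vector `z` turns the bound `3S²` into at most `3S² + 6S‖z‖² + ‖z‖⁴`, which is below
`3(S + ‖z‖²)²`. -/
theorem sum_norm_sum_pow_four_le (z : J → E) (s : Finset J) :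
    ∑ σ : J → ℤˣ, ‖∑ i ∈ s, ((σ i : ℤ) : ℝ) • z i‖ ^ 4 ≤
      ∑ _σ : J → ℤˣ, 3 * (∑ i ∈ s, ‖z i‖ ^ 2) ^ 2 := by
  induction s using Finset.induction_on with
  | empty => simp
  | insert i s hi ih =>
    set X : (J → ℤˣ) → E := fun σ => ∑ j ∈ s, ((σ j : ℤ) : ℝ) • z j
    have h : ∀ σ : J → ℤˣ,
        ‖∑ j ∈ insert i s, ((σ j : ℤ) : ℝ) • z j‖ ^ 4 +
        ‖∑ j ∈ insert i s, ((flipSign i σ j : ℤ) : ℝ) • z j‖ ^ 4 ≤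
        (‖X σ‖ ^ 4 + 6 * ‖X σ‖ ^ 2 * ‖z i‖ ^ 2 + ‖z i‖ ^ 4) +
        (‖X (flipSign i σ)‖ ^ 4 + 6 * ‖X (flipSign i σ)‖ ^ 2 * ‖z i‖ ^ 2 + ‖z i‖ ^ 4) := by
      intro σ
      have hX : X (flipSign i σ) = X σ := sum_flipSign_eq_of_notMem z hi σ
      rw [hX, Finset.sum_insert hi, Finset.sum_insert hi, sum_flipSign_eq_of_notMem z hi,
        flipSign_self]
      simp only [Units.val_neg, Int.cast_neg, neg_smul]
      exact (norm_pow_four_add_sign_le _ _ _).trans_eq (by ring)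
    refine (sum_le_sum_of_add_flipSign_le i h).trans ?_
    rw [Finset.sum_add_distrib, Finset.sum_add_distrib, ← Finset.sum_mul, ← Finset.mul_sum,
      sum_norm_sum_sq z s]
    simp only [Finset.sum_insert hi]
    refine (add_le_add_left (add_le_add_left ih _) _).trans ?_
    rw [Finset.mul_sum, Finset.sum_mul, ← Finset.sum_add_distrib, ← Finset.sum_add_distrib]
    refine Finset.sum_le_sum fun σ _ => ?_
    have : 0 ≤ ‖z i‖ ^ 4 := by positivity
    nlinarith [this]

theorem sum_norm_sum_le (z : J → E) :
    ∑ σ : J → ℤˣ, ‖∑ i, ((σ i : ℤ) : ℝ) • z i‖ ≤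
      Fintype.card (J → ℤˣ) * √(∑ i, ‖z i‖ ^ 2) := by
  refine le_of_sq_le_sq ?_ (by positivity)
  have h := sq_sum_le_card_mul_sum_sq (s := (Finset.univ : Finset (J → ℤˣ)))
    (f := fun σ => ‖∑ i, ((σ i : ℤ) : ℝ) • z i‖)
  rw [sum_norm_sum_sq z Finset.univ] at h
  refine h.trans (le_of_eq ?_)
  rw [mul_pow, Real.sq_sqrt (by positivity)]
  simp only [Finset.sum_const, Finset.card_univ, nsmul_eq_mul]
  ring

/-- The best constant: the quartic touches the line `x - a` at `x = 4a/3`, so `(3x - 4a)²` divides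
the difference. -/
theorem sub_le_mul_pow_four_div {x a : ℝ} (ha : 0 < a) :
    x - a ≤ 27 / 256 * x ^ 4 / a ^ 3 := by
  rw [le_div_iff₀ (by positivity)]
  nlinarith [sq_nonneg (3 * x - 4 * a), mul_nonneg (sq_nonneg (3 * x - 4 * a))
    (by positivity : 0 ≤ (3 * x + 4 * a) ^ 2 + 32 * a ^ 2)]

theorem sum_max_norm_sum_sub_le (z : J → E) {a : ℝ} (ha : 0 < a) :
    ∑ σ : J → ℤˣ, max (‖∑ i, ((σ i : ℤ) : ℝ) • z i‖ - a) 0 ≤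
      Fintype.card (J → ℤˣ) * (81 / 256 * (∑ i, ‖z i‖ ^ 2) ^ 2 / a ^ 3) := by
  calc _ ≤ ∑ σ : J → ℤˣ, 27 / 256 / a ^ 3 * ‖∑ i, ((σ i : ℤ) : ℝ) • z i‖ ^ 4 :=
        Finset.sum_le_sum fun σ _ => max_le
          ((sub_le_mul_pow_four_div ha).trans_eq (by ring)) (by positivity)
    _ ≤ 27 / 256 / a ^ 3 * ∑ _σ : J → ℤˣ, 3 * (∑ i, ‖z i‖ ^ 2) ^ 2 := by
        rw [← Finset.mul_sum]
        exact mul_le_mul_of_nonneg_left (sum_norm_sum_pow_four_le z Finset.univ) (by positivity)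
    _ = _ := by
        simp only [Finset.sum_const, Finset.card_univ, nsmul_eq_mul]
        ring

end Moments

/-! ### Symmetrization with twice as many signs -/

/-- The number of negative signs, capped at `N`. -/
def cappedNegCount (N : ℕ) (σ : Fin N ⊕ Fin N → ℤˣ) : ℕ :=
  min (Finset.univ.filter fun i => σ i = -1).card N

/-- The mean of `min k N / N` for the number `k` of negative signs among `2 N` random signs. -/
noncomputable def symmetrizationFactor (N : ℕ) : ℝ :=
  (∑ σ : Fin N ⊕ Fin N → ℤˣ, (cappedNegCount N σ : ℝ) / N) /
    Fintype.card (Fin N ⊕ Fin N → ℤˣ)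

theorem sum_sum_signs_eq_zero {J : Type*} [Fintype J] [DecidableEq J] :
    ∑ σ : J → ℤˣ, ∑ i, ((σ i : ℤ) : ℝ) = 0 := by
  rw [Finset.sum_comm]
  refine Finset.sum_eq_zero fun i _ => ?_
  have h := sum_comp_flipSign i (fun σ : J → ℤˣ => ((σ i : ℤ) : ℝ))
  simp only [flipSign_self, Units.val_neg, Int.cast_neg, Finset.sum_neg_distrib] at h
  linarith

theorem sum_signs_eq {J : Type*} [Fintype J] [DecidableEq J] (σ : J → ℤˣ) :
    ∑ i, ((σ i : ℤ) : ℝ) =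
      Fintype.card J - 2 * ((Finset.univ.filter fun i => σ i = -1).card : ℝ) := by
  have : ∀ i, ((σ i : ℤ) : ℝ) = 1 - 2 * (if σ i = -1 then 1 else 0) := by
    intro i
    rcases Int.units_eq_one_or (σ i) with h | h <;> simp [h]
    norm_num
  simp only [this, Finset.sum_sub_distrib, ← Finset.mul_sum, Finset.sum_boole]
  simp

/-- With `k` negative signs the signs sum to `2(N - k)`, so the shortfall `(N - k)₊` is a quarter of
the sum plus its absolute value. The sum has mean zero, and its absolute value has mean at most
`√(2N)`. -/
theorem le_symmetrizationFactor {N : ℕ} (hN : 0 < N) :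
    1 - √(2 * N) / (4 * N) ≤ symmetrizationFactor N := by
  have hN' : (0 : ℝ) < N := by exact_mod_cast hN
  have hcard : (0 : ℝ) < Fintype.card (Fin N ⊕ Fin N → ℤˣ) := by
    exact_mod_cast Fintype.card_pos
  have h1 := sum_norm_sum_le (fun _ : Fin N ⊕ Fin N => (1 : ℝ))
  simp only [smul_eq_mul, mul_one, norm_one, one_pow, Finset.sum_const, Finset.card_univ,
    Fintype.card_sum, Fintype.card_fin, nsmul_eq_mul, Real.norm_eq_abs] at h1
  have h2 : ∀ σ : Fin N ⊕ Fin N → ℤˣ,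
      1 - |∑ i, ((σ i : ℤ) : ℝ)| / (4 * N) ≤
        (cappedNegCount N σ : ℝ) / N + (∑ i, ((σ i : ℤ) : ℝ)) / (4 * N) := by
    intro σ
    rw [sum_signs_eq σ, cappedNegCount]
    set k := (Finset.univ.filter fun i => σ i = -1).card
    have hcN : (Fintype.card (Fin N ⊕ Fin N) : ℝ) = 2 * N := by simp; ring
    rw [hcN]
    push_cast
    have e : ∀ x y w : ℝ, 1 - x / (4 * N) ≤ w / N + y / (4 * N) ↔ 4 * N ≤ 4 * w + y + x := by
      intro x y w
      rw [← sub_nonneg, ← sub_nonneg (b := 4 * (N : ℝ))]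
      have : w / N + y / (4 * N) - (1 - x / (4 * N)) = (4 * w + y + x - 4 * N) / (4 * N) := by
        field_simp
        ring
      rw [this, div_nonneg_iff]
      constructor
      · rintro (h | h)
        · exact h.1
        · linarith [h.2]
      · intro h; left; exact ⟨h, by positivity⟩
    rw [e]
    rcases le_total (k : ℝ) N with h | h
    · rw [min_eq_left h]
      linarith [le_abs_self (2 * (N : ℝ) - 2 * k)]
    · rw [min_eq_right h]
      linarith [neg_abs_le (2 * (N : ℝ) - 2 * k)]
  have h3 := Finset.sum_le_sum fun σ (_ : σ ∈ Finset.univ) => h2 σ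
  rw [Finset.sum_add_distrib, Finset.sum_sub_distrib, ← Finset.sum_div,
    ← Finset.sum_div (f := fun σ : Fin N ⊕ Fin N → ℤˣ => ∑ i, ((σ i : ℤ) : ℝ)),
    sum_sum_signs_eq_zero] at h3
  rw [symmetrizationFactor, le_div_iff₀ hcard]
  simp only [Finset.sum_const, Finset.card_univ, nsmul_eq_mul, mul_one, zero_div, add_zero] at h3
  refine le_trans ?_ h3
  have h4 : (∑ σ : Fin N ⊕ Fin N → ℤˣ, |∑ i, ((σ i : ℤ) : ℝ)|) / (4 * N) ≤
      Fintype.card (Fin N ⊕ Fin N → ℤˣ) * √((N + N : ℕ) : ℝ) / (4 * N) := by gcongr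
  have e2 : ((N + N : ℕ) : ℝ) = 2 * N := by push_cast; ring
  rw [e2] at h4
  have : (1 - √(2 * N) / (4 * N)) * (Fintype.card (Fin N ⊕ Fin N → ℤˣ) : ℝ) =
    Fintype.card (Fin N ⊕ Fin N → ℤˣ) -
      Fintype.card (Fin N ⊕ Fin N → ℤˣ) * √(2 * N) / (4 * N) := by ring
  rw [this]
  linarith

section Symmetrization

variable {Z T : Type*} [MeasurableSpace Z] [Finite T] [Nonempty T]

theorem abs_ciSup_le {g : T → ℝ} {C : ℝ} (h : ∀ t, |g t| ≤ C) : |⨆ t, g t| ≤ C := by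
  refine abs_le.2 ⟨?_, ciSup_le fun t => (le_abs_self _).trans (h t)⟩
  obtain ⟨t⟩ := ‹Nonempty T›
  exact (neg_le_of_abs_le (h t)).trans (le_ciSup (Set.finite_range g).bddAbove t)

theorem exists_injOn_of_card_le {J : Type*} {N : ℕ} (hN : 0 < N) (B : Finset J)
    (hB : B.card ≤ N) : ∃ e : J → Fin N, Set.InjOn e B := by
  classical
  obtain ⟨e⟩ : Nonempty (B ↪ Fin N) := Function.Embedding.nonempty_of_card_le (by simpa using hB)
  refine ⟨fun i => if h : i ∈ B then e ⟨i, h⟩ else ⟨0, hN⟩, fun i hi j hj hij => ?_⟩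
  simp only [Finset.mem_coe] at hi hj
  simpa [hi, hj] using hij

/-- Replacing the coordinates outside `B` of a sample of size `N` by fresh copies. -/
theorem measurePreserving_ite {J : Type*} [Fintype J] [DecidableEq J] (D : Measure Z)
    [IsProbabilityMeasure D] {N : ℕ} (B : Finset J) {e : J → Fin N} (he : Set.InjOn e B) :
    MeasurePreserving (fun (p : (Fin N → Z) × (J → Z)) (i : J) =>
        if i ∈ B then p.1 (e i) else p.2 i)
      ((Measure.pi fun _ => D).prod (Measure.pi fun _ => D)) (Measure.pi fun _ : J => D) := by
  have hinj : Function.Injective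
      (fun i : J => if i ∈ B then (Sum.inl (e i) : Fin N ⊕ J) else Sum.inr i) := by
    intro i j hij
    by_cases hi : i ∈ B <;> by_cases hj : j ∈ B <;> simp [hi, hj] at hij
    · exact he hi hj hij
    · exact hij
  have h := (measurePreserving_comp_injective D hinj).comp
    (measurePreserving_sumPiEquivProdPi_symm (X := fun _ : Fin N ⊕ J => Z) fun _ => D)
  convert h using 1
  ext p i
  by_cases hi : i ∈ B <;> simp [hi, MeasurableEquiv.coe_sumPiEquivProdPi_symm]

/-- Fix the signs and choose a set `B` of at most `N` negative indices. Put sample points on `B` and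
integrate out the other coordinates: by Jensen the supremum dominates `a t + (∑ σᵢ) P + ∑_B (P - f t
(S ·))`. Averaging over cyclic placements of the sample replaces the sum over `B` by `|B|/N` times
the full deviation. -/
theorem exists_integrable_le_of_signs (D : Measure Z) [IsProbabilityMeasure D] {N : ℕ}
    (hN : 0 < N) (f : T → Z → ℝ) (hf : ∀ t, Measurable (f t)) {C : ℝ} (hC : ∀ t z, |f t z| ≤ C)
    (a : T → ℝ) (σ : Fin N ⊕ Fin N → ℤˣ) :
    ∃ V : (Fin N → Z) → ℝ, Integrable V (Measure.pi fun _ => D) ∧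
      ∫ S, V S ∂(Measure.pi fun _ => D) =
        ∫ z, (⨆ t, (a t + ∑ i, ((σ i : ℤ) : ℝ) * f t (z i))) ∂(Measure.pi fun _ => D) ∧
      ∀ S t, a t + (∑ i, ((σ i : ℤ) : ℝ)) * (∫ z, f t z ∂D) +
        (cappedNegCount N σ : ℝ) / N * (N * (∫ z, f t z ∂D) - ∑ i, f t (S i)) ≤ V S := by
  classical
  have : NeZero N := ⟨hN.ne'⟩
  have hN' : (N : ℝ) ≠ 0 := by exact_mod_cast hN.ne'
  set μN : Measure (Fin N → Z) := Measure.pi fun _ => D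
  set μJ : Measure (Fin N ⊕ Fin N → Z) := Measure.pi fun _ => D
  obtain ⟨B, hBsub, hBcard⟩ := Finset.exists_subset_card_eq
    (show cappedNegCount N σ ≤ (Finset.univ.filter fun i => σ i = -1).card from min_le_left _ _)
  obtain ⟨e, he⟩ := exists_injOn_of_card_le hN B (hBcard.le.trans (min_le_right _ _))
  have hσB : ∀ i ∈ B, ((σ i : ℤ) : ℝ) = -1 := by
    intro i hi
    have := (Finset.mem_filter.1 (hBsub hi)).2
    simp [this]
  set W : (Fin N ⊕ Fin N → Z) → ℝ := fun z => ⨆ t, (a t + ∑ i, ((σ i : ℤ) : ℝ) * f t (z i)) with hW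
  have hYm : ∀ t, Measurable fun z : Fin N ⊕ Fin N → Z => a t + ∑ i, ((σ i : ℤ) : ℝ) * f t (z i) := fun t =>
    measurable_const.add (Finset.measurable_fun_sum _ fun i _ =>
      measurable_const.mul ((hf t).comp (measurable_pi_apply i)))
  have hWm : Measurable W := Measurable.iSup hYm
  obtain ⟨Ca, hCa⟩ : ∃ Ca, ∀ t, |a t| ≤ Ca := by
    obtain ⟨Ca, h⟩ := (Set.finite_range fun t => |a t|).bddAbove
    exact ⟨Ca, fun t => h ⟨t, rfl⟩⟩
  have hYC : ∀ t (z : Fin N ⊕ Fin N → Z), |a t + ∑ i, ((σ i : ℤ) : ℝ) * f t (z i)| ≤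
      Ca + ∑ _i : Fin N ⊕ Fin N, C := by
    intro t z
    refine (abs_add_le _ _).trans (add_le_add (hCa t) ((Finset.abs_sum_le_sum_abs _ _).trans
      (Finset.sum_le_sum fun i _ => ?_)))
    rw [abs_mul]
    rcases Int.units_cast_eq_or (σ i) with h | h <;> simpa [h] using hC t (z i)
  have hWC : ∀ z, |W z| ≤ Ca + ∑ _i : Fin N ⊕ Fin N, C := fun z => abs_ciSup_le fun t => hYC t z
  -- The shift by `c` is addition in `Fin N`, hence cyclic: as `c` varies, each index of `B` meets
  -- every sample point once.
  let G : Fin N → (Fin N → Z) × (Fin N ⊕ Fin N → Z) → Fin N ⊕ Fin N → Z := fun c p i =>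
    if i ∈ B then p.1 (e i + c) else p.2 i
  have hG : ∀ c, MeasurePreserving (G c) (μN.prod μJ) μJ := fun c =>
    measurePreserving_ite D B (e := fun i => e i + c) fun i hi j hj h => he hi hj (by simpa using h)
  have hint : ∀ c, Integrable (fun p => W (G c p)) (μN.prod μJ) := fun c =>
    integrable_of_measurable_of_abs_le (hWm.comp (hG c).measurable) fun p => hWC _
  refine ⟨fun S => (1 / N : ℝ) * ∑ c, ∫ z', W (G c (S, z')) ∂μJ, ?_, ?_, ?_⟩
  · exact (integrable_finsetSum _ fun c _ => (hint c).integral_prod_left).const_mul _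
  · rw [integral_const_mul, integral_finsetSum _ fun c _ => (hint c).integral_prod_left]
    have : ∀ c, ∫ S, ∫ z', W (G c (S, z')) ∂μJ ∂μN = ∫ z, W z ∂μJ := by
      intro c
      have h := integral_map (hG c).measurable.aemeasurable
        (hWm.aestronglyMeasurable (μ := (μN.prod μJ).map (G c)))
      rw [(hG c).map_eq] at h
      rw [← integral_prod _ (hint c), h]
    simp only [this, Finset.sum_const, Finset.card_univ, Fintype.card_fin, nsmul_eq_mul]
    field_simp
  · intro S t
    set P := ∫ z, f t z ∂D
    have hmS : ∀ c, Measurable fun z' : Fin N ⊕ Fin N → Z => G c (S, z') := fun c =>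
      (hG c).measurable.comp (measurable_const.prodMk measurable_id)
    have hfi : ∀ c i, Integrable (fun z' : Fin N ⊕ Fin N → Z => f t (G c (S, z') i)) μJ := fun c i =>
      integrable_of_measurable_of_abs_le
        ((hf t).comp ((measurable_pi_apply i).comp (hmS c))) fun z => hC _ _
    have hfint : ∀ c i, ∫ z', f t (G c (S, z') i) ∂μJ =
        if i ∈ B then f t (S (e i + c)) else P := by
      intro c i
      by_cases hi : i ∈ B
      · simp [G, hi]
      · simp only [G, hi, if_false]
        have hmp := measurePreserving_eval (fun _ : Fin N ⊕ Fin N => D) i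
        have h2 := integral_map (μ := μJ) (f := f t) hmp.measurable.aemeasurable
          (hf t).aestronglyMeasurable
        rw [hmp.map_eq] at h2
        exact h2.symm
    -- Jensen: the mean over fresh points of the expression at a fixed `t` is at most the mean of
    -- the supremum.
    have h1 : ∀ c, a t + ∑ i, ((σ i : ℤ) : ℝ) * (if i ∈ B then f t (S (e i + c)) else P) ≤
        ∫ z', W (G c (S, z')) ∂μJ := by
      intro c
      have : a t + ∑ i, ((σ i : ℤ) : ℝ) * (if i ∈ B then f t (S (e i + c)) else P) =
          ∫ z', (a t + ∑ i, ((σ i : ℤ) : ℝ) * f t (G c (S, z') i)) ∂μJ := by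
        rw [integral_add (integrable_const _)
          (integrable_finsetSum _ fun i _ => (hfi c i).const_mul _),
          integral_finsetSum _ fun i _ => (hfi c i).const_mul _]
        simp only [integral_const_mul, hfint]
        simp
      rw [this]
      refine integral_mono ((integrable_const _).add
        (integrable_finsetSum _ fun i _ => (hfi c i).const_mul _))
        (integrable_of_measurable_of_abs_le (hWm.comp (hmS c)) fun p => hWC _) fun z' => ?_
      exact le_ciSup (f := fun t => a t + ∑ i, ((σ i : ℤ) : ℝ) * f t (G c (S, z') i))
        (Set.finite_range _).bddAbove t
    have h2 : ∀ c, ∑ i, ((σ i : ℤ) : ℝ) * (if i ∈ B then f t (S (e i + c)) else P) =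
        (∑ i, ((σ i : ℤ) : ℝ)) * P + ∑ i ∈ B, (P - f t (S (e i + c))) := by
      intro c
      rw [Finset.sum_mul, ← Finset.sum_filter_add_sum_filter_not Finset.univ (· ∈ B),
        ← Finset.sum_filter_add_sum_filter_not Finset.univ (· ∈ B)
          (fun i => ((σ i : ℤ) : ℝ) * P)]
      simp only [Finset.filter_mem_eq_inter, Finset.univ_inter]
      have e1 : ∑ i ∈ B, ((σ i : ℤ) : ℝ) * (if i ∈ B then f t (S (e i + c)) else P) =
          ∑ i ∈ B, ((σ i : ℤ) : ℝ) * P + ∑ i ∈ B, (P - f t (S (e i + c))) := by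
        rw [← Finset.sum_add_distrib]
        refine Finset.sum_congr rfl fun i hi => ?_
        rw [if_pos hi, hσB i hi]
        ring
      have e2 : ∑ i with i ∉ B, ((σ i : ℤ) : ℝ) * (if i ∈ B then f t (S (e i + c)) else P) =
          ∑ i with i ∉ B, ((σ i : ℤ) : ℝ) * P :=
        Finset.sum_congr rfl fun i hi => by rw [if_neg (Finset.mem_filter.1 hi).2]
      rw [e1, e2]
      ring
    have h3 : ∑ c, ∑ i ∈ B, (P - f t (S (e i + c))) =
        (cappedNegCount N σ : ℝ) * (N * P - ∑ j, f t (S j)) := by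
      rw [Finset.sum_comm]
      have : ∀ i ∈ B, ∑ c, (P - f t (S (e i + c))) = N * P - ∑ j, f t (S j) := by
        intro i _
        rw [Finset.sum_sub_distrib]
        have := Equiv.sum_comp (Equiv.addLeft (e i)) fun j => f t (S j)
        simp only [Equiv.coe_addLeft] at this
        rw [this]
        simp
      rw [Finset.sum_congr rfl this, Finset.sum_const, hBcard, nsmul_eq_mul]
    have h4 := Finset.sum_le_sum fun c (_ : c ∈ Finset.univ) => h1 c
    simp only [h2] at h4
    rw [Finset.sum_add_distrib, Finset.sum_add_distrib, h3] at h4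
    simp only [Finset.sum_const, Finset.card_univ, Fintype.card_fin, nsmul_eq_mul] at h4
    refine le_trans (le_of_eq ?_) (mul_le_mul_of_nonneg_left h4 (by positivity))
    field_simp
    ring

/-- **Symmetrization** with `2 N` independent signs. -/
theorem integral_ciSup_le_integral_signs (D : Measure Z) [IsProbabilityMeasure D] {N : ℕ}
    (hN : 0 < N) (f : T → Z → ℝ) (hf : ∀ t, Measurable (f t)) {C : ℝ} (hC : ∀ t z, |f t z| ≤ C)
    (a : T → ℝ) :
    Fintype.card (Fin N ⊕ Fin N → ℤˣ) * ∫ S, (⨆ t, (a t + symmetrizationFactor N *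
        (N * (∫ z, f t z ∂D) - ∑ i, f t (S i)))) ∂(Measure.pi fun _ : Fin N => D) ≤
      ∑ σ : Fin N ⊕ Fin N → ℤˣ,
        ∫ z, (⨆ t, (a t + ∑ i, ((σ i : ℤ) : ℝ) * f t (z i))) ∂(Measure.pi fun _ => D) := by
  choose V hVint hV hle using exists_integrable_le_of_signs D hN f hf hC a
  have hcard : (0 : ℝ) < Fintype.card (Fin N ⊕ Fin N → ℤˣ) := by
    exact_mod_cast Fintype.card_pos
  simp only [← hV]
  rw [← integral_finsetSum _ fun σ _ => hVint σ, ← integral_const_mul]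
  obtain ⟨Ca, hCa⟩ : ∃ Ca, ∀ t, |a t| ≤ Ca := by
    obtain ⟨Ca, h⟩ := (Set.finite_range fun t => |a t|).bddAbove
    exact ⟨Ca, fun t => h ⟨t, rfl⟩⟩
  have hP : ∀ t, |∫ z, f t z ∂D| ≤ C := fun t => by
    simpa using norm_integral_le_of_norm_le_const (μ := D) (f := f t) (C := C)
      (Filter.Eventually.of_forall fun z => hC t z)
  refine integral_mono (Integrable.const_mul (integrable_of_measurable_of_abs_le
    (C := Ca + |symmetrizationFactor N| * (N * C + N * C)) ?_ ?_) _)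
    (integrable_finsetSum _ fun σ _ => hVint σ) fun S => ?_
  · exact Measurable.iSup fun t => measurable_const.add (measurable_const.mul
      (measurable_const.sub (Finset.measurable_fun_sum _ fun i _ =>
        (hf t).comp (measurable_pi_apply i))))
  · refine fun S => abs_ciSup_le fun t => (abs_add_le _ _).trans (add_le_add (hCa t) ?_)
    rw [abs_mul]
    refine mul_le_mul_of_nonneg_left ((abs_sub _ _).trans (add_le_add ?_ ?_)) (abs_nonneg _)
    · rw [abs_mul, Nat.abs_cast]
      exact mul_le_mul_of_nonneg_left (hP t) (Nat.cast_nonneg _)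
    · refine (Finset.abs_sum_le_sum_abs _ _).trans
        ((Finset.sum_le_sum fun i _ => hC t (S i)).trans (by simp))
  · show (Fintype.card (Fin N ⊕ Fin N → ℤˣ) : ℝ) * _ ≤ ∑ σ, V σ S
    rw [← le_div_iff₀' hcard]
    refine ciSup_le fun t => ?_
    rw [le_div_iff₀' hcard]
    -- Summed over all signs the term `(∑ σᵢ) P` cancels and the weights `|B|/N` add up to the
    -- symmetrization factor.
    refine le_trans (le_of_eq ?_) (Finset.sum_le_sum fun σ _ => hle σ S t)
    rw [Finset.sum_add_distrib, Finset.sum_add_distrib, ← Finset.sum_mul, ← Finset.sum_mul,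
      sum_sum_signs_eq_zero, symmetrizationFactor]
    simp only [Finset.sum_const, Finset.card_univ, nsmul_eq_mul]
    field_simp
    ring

end Symmetrization

/-! ### Penalized deviations of linear predictors -/

theorem ae_sum_norm_sq_sum_eq {𝒳 H : Type*} [MeasurableSpace 𝒳] [NormedAddCommGroup H]
    {φ : 𝒳 → H} {D : Measure (𝒳 × ℝ)} [IsProbabilityMeasure D]
    {N : ℕ} (hTr : ∀ᵐ S ∂(Measure.pi fun _ : Fin N => D), ∑ i, ‖φ (S i).1‖ ^ 2 = N) :
    ∀ᵐ z ∂(Measure.pi fun _ : Fin N ⊕ Fin N => D), ∑ i, ‖φ (z i).1‖ ^ 2 = 2 * N := by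
  have h1 := (measurePreserving_comp_injective D
    (Sum.inl_injective (α := Fin N) (β := Fin N))).quasiMeasurePreserving.ae hTr
  have h2 := (measurePreserving_comp_injective D
    (Sum.inr_injective (α := Fin N) (β := Fin N))).quasiMeasurePreserving.ae hTr
  filter_upwards [h1, h2] with z hz1 hz2
  rw [Fintype.sum_sum_type, hz1, hz2]
  ring

/-- Rademacher complexity of a finite class of Lipschitz losses of linear predictors, penalized
by their norms. -/
theorem sum_ciSup_signs_le {𝒳 H T : Type*} [NormedAddCommGroup H]
    [InnerProductSpace ℝ H] [Finite T] [Nonempty T] (φ : 𝒳 → H) {L : ℝ≥0}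
    {ℓ : ℝ → ℝ → ℝ} (hℓ_lip : ∀ y, LipschitzWith L fun u => ℓ u y) {J : Type*} [Fintype J]
    [DecidableEq J] (w : T → H) {M q : ℝ} (hw : ∀ t, L * ‖w t‖ ≤ M) (z : J → 𝒳 × ℝ) :
    ∑ σ : J → ℤˣ, (⨆ t, (-(q * (L * ‖w t‖)) +
        ∑ i, ((σ i : ℤ) : ℝ) * ℓ (inner ℝ (w t) (φ (z i).1)) (z i).2)) ≤
      M * ∑ σ : J → ℤˣ, max (‖∑ i, ((σ i : ℤ) : ℝ) • φ (z i).1‖ - q) 0 := by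
  -- Contraction removes the loss while the penalty rides along as offset; Cauchy–Schwarz then
  -- leaves `L‖w‖ (X - q)`.
  refine (sum_ciSup_le_of_abs_sub_le _ _
    (fun i t => L * inner ℝ (w t) (φ (z i).1)) fun i t t' => ?_).trans ?_
  · have := (hℓ_lip (z i).2).dist_le_mul (inner ℝ (w t) (φ (z i).1)) (inner ℝ (w t') (φ (z i).1))
    rw [← mul_sub, abs_mul, NNReal.abs_eq]
    exact this
  · rw [Finset.mul_sum]
    refine Finset.sum_le_sum fun σ _ => ciSup_le fun t => ?_
    have h1 : ∑ i, ((σ i : ℤ) : ℝ) * (L * inner ℝ (w t) (φ (z i).1)) =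
        L * inner ℝ (w t) (∑ i, ((σ i : ℤ) : ℝ) • φ (z i).1) := by
      rw [inner_sum, Finset.mul_sum]
      refine Finset.sum_congr rfl fun i _ => ?_
      rw [inner_smul_right]; ring
    rw [h1]
    have h2 := real_inner_le_norm (w t) (∑ i, ((σ i : ℤ) : ℝ) • φ (z i).1)
    set X := ‖∑ i, ((σ i : ℤ) : ℝ) • φ (z i).1‖
    have hL : (0 : ℝ) ≤ L := L.2
    calc _ ≤ -(q * (L * ‖w t‖)) + L * (‖w t‖ * X) := by gcongr
      _ = (L * ‖w t‖) * (X - q) := by ring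
      _ ≤ (L * ‖w t‖) * max (X - q) 0 := by gcongr; exact le_max_left _ _
      _ ≤ M * max (X - q) 0 := by gcongr; exact hw t

section LinearPredictors

variable {𝒳 H : Type*} [MeasurableSpace 𝒳] [NormedAddCommGroup H] [InnerProductSpace ℝ H]

theorem measurable_loss_inner {φ : 𝒳 → H} (hφ : StronglyMeasurable φ) {ℓ : ℝ → ℝ → ℝ}
    (hℓ : Measurable (Function.uncurry ℓ)) (w : H) :
    Measurable fun z : 𝒳 × ℝ => ℓ (inner ℝ w (φ z.1)) z.2 := by
  have h1 : Measurable fun x : 𝒳 => (inner ℝ w (φ x) : ℝ) :=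
    (stronglyMeasurable_const.inner hφ).measurable
  exact hℓ.comp ((h1.comp measurable_fst).prodMk measurable_snd)

variable {φ : 𝒳 → H} {D : Measure (𝒳 × ℝ)} {N : ℕ} {L : ℝ≥0} {b : ℝ} {ℓ : ℝ → ℝ → ℝ}

/-- The penalized deviation between population and empirical risk, multiplied by the sample
size. -/
noncomputable def deviation (φ : 𝒳 → H) (D : Measure (𝒳 × ℝ)) (L : ℝ≥0) (ℓ : ℝ → ℝ → ℝ) (p : ℝ)
    {N : ℕ} (w : H) (S : Fin N → 𝒳 × ℝ) : ℝ :=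
  N * populationRisk D φ ℓ w - ∑ i, ℓ (inner ℝ w (φ (S i).1)) (S i).2 - p * (L * ‖w‖)

theorem populationRisk_mem_Icc [IsProbabilityMeasure D] (hφ : StronglyMeasurable φ)
    (hℓ_meas : Measurable (Function.uncurry ℓ)) (hℓ_range : ∀ u y, ℓ u y ∈ Set.Icc 0 b) (w : H) :
    populationRisk D φ ℓ w ∈ Set.Icc 0 b := by
  have hint : Integrable (fun z : 𝒳 × ℝ => ℓ (inner ℝ w (φ z.1)) z.2) D :=
    integrable_of_measurable_of_abs_le (measurable_loss_inner hφ hℓ_meas w) fun z =>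
      (abs_of_nonneg (hℓ_range _ _).1).trans_le (hℓ_range _ _).2
  refine ⟨integral_nonneg fun z => (hℓ_range _ _).1, ?_⟩
  have := integral_mono hint (integrable_const b) fun z => (hℓ_range (inner ℝ w (φ z.1)) z.2).2
  rw [integral_const, probReal_univ, one_smul] at this
  exact this

theorem measurable_deviation (hφ : StronglyMeasurable φ)
    (hℓ_meas : Measurable (Function.uncurry ℓ)) (p : ℝ) (w : H) :
    Measurable (deviation φ D L ℓ p w : (Fin N → 𝒳 × ℝ) → ℝ) :=
  (measurable_const.sub (Finset.measurable_fun_sum _ fun i _ =>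
    (measurable_loss_inner hφ hℓ_meas w).comp (measurable_pi_apply i))).sub measurable_const

theorem abs_deviation_le [IsProbabilityMeasure D] (hφ : StronglyMeasurable φ)
    (hℓ_meas : Measurable (Function.uncurry ℓ)) (hℓ_range : ∀ u y, ℓ u y ∈ Set.Icc 0 b) {p M : ℝ}
    (hp : 0 ≤ p) {w : H} (hw : L * ‖w‖ ≤ M) (S : Fin N → 𝒳 × ℝ) :
    |deviation φ D L ℓ p w S| ≤ N * b + N * b + p * M := by
  have hP := populationRisk_mem_Icc (D := D) hφ hℓ_meas hℓ_range w
  refine (abs_sub _ _).trans (add_le_add ((abs_sub _ _).trans (add_le_add ?_ ?_)) ?_)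
  · rw [abs_of_nonneg (mul_nonneg (Nat.cast_nonneg _) hP.1)]
    exact mul_le_mul_of_nonneg_left hP.2 (Nat.cast_nonneg _)
  · rw [abs_of_nonneg (Finset.sum_nonneg fun i _ => (hℓ_range _ _).1)]
    exact (Finset.sum_le_sum fun i _ => (hℓ_range _ _).2).trans (by simp)
  · rw [abs_of_nonneg (by positivity)]
    gcongr

theorem deviation_sub_le (hℓ_range : ∀ u y, ℓ u y ∈ Set.Icc 0 b) (p : ℝ) (w : H) (i : Fin N)
    (S S' : Fin N → 𝒳 × ℝ) (h : ∀ j ≠ i, S j = S' j) :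
    deviation φ D L ℓ p w S - deviation φ D L ℓ p w S' ≤ b := by
  have h1 : ∑ j ∈ Finset.univ.erase i, ℓ (inner ℝ w (φ (S j).1)) (S j).2 =
      ∑ j ∈ Finset.univ.erase i, ℓ (inner ℝ w (φ (S' j).1)) (S' j).2 :=
    Finset.sum_congr rfl fun j hj => by rw [h j (Finset.ne_of_mem_erase hj)]
  rw [deviation, deviation, ← Finset.sum_erase_add _ _ (Finset.mem_univ i),
    ← Finset.sum_erase_add _ _ (Finset.mem_univ i), h1]
  linarith [(hℓ_range (inner ℝ w (φ (S i).1)) (S i).2).1,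
    (hℓ_range (inner ℝ w (φ (S' i).1)) (S' i).2).2]

theorem continuous_populationRisk [IsProbabilityMeasure D] (hφ : StronglyMeasurable φ)
    (hℓ_meas : Measurable (Function.uncurry ℓ)) (hℓ_lip : ∀ y, LipschitzWith L fun u => ℓ u y)
    (hℓ_range : ∀ u y, ℓ u y ∈ Set.Icc 0 b) : Continuous (populationRisk D φ ℓ) := by
  refine continuous_of_dominated (bound := fun _ => b)
    (fun w => (measurable_loss_inner hφ hℓ_meas w).aestronglyMeasurable)
    (fun w => Filter.Eventually.of_forall fun z =>
      (abs_of_nonneg (hℓ_range _ _).1).trans_le (hℓ_range _ _).2) (integrable_const _)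
    (Filter.Eventually.of_forall fun z => ?_)
  exact (hℓ_lip z.2).continuous.comp (continuous_id.inner continuous_const)

theorem continuous_deviation [IsProbabilityMeasure D] (hφ : StronglyMeasurable φ)
    (hℓ_meas : Measurable (Function.uncurry ℓ)) (hℓ_lip : ∀ y, LipschitzWith L fun u => ℓ u y)
    (hℓ_range : ∀ u y, ℓ u y ∈ Set.Icc 0 b) (p : ℝ) (S : Fin N → 𝒳 × ℝ) :
    Continuous fun w => deviation φ D L ℓ p w S := by
  have h1 := continuous_populationRisk (D := D) hφ hℓ_meas hℓ_lip hℓ_range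
  refine ((continuous_const.mul h1).sub (continuous_finsetSum _ fun i _ => ?_)).sub
    (continuous_const.mul (continuous_const.mul continuous_norm))
  exact (hℓ_lip _).continuous.comp (continuous_id.inner continuous_const)

/-- The penalty is scaled by `γ` so that `γ` factors out after symmetrization. The moment estimate
enters only through `hκ`, so the same argument serves the fourth moment (`p = 2√N`) and the first
(`p = 0`). -/
theorem integral_ciSup_deviation_le {T : Type*} [Finite T] [Nonempty T] [IsProbabilityMeasure D]
    (hφ : StronglyMeasurable φ) (hN : 0 < N)
    (hTr : ∀ᵐ S ∂(Measure.pi fun _ : Fin N => D), ∑ i, ‖φ (S i).1‖ ^ 2 = N)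
    (hℓ_meas : Measurable (Function.uncurry ℓ)) (hℓ_lip : ∀ y, LipschitzWith L fun u => ℓ u y)
    (hℓ_range : ∀ u y, ℓ u y ∈ Set.Icc 0 b) (w : T → H) {M p κ : ℝ} (hM : 0 ≤ M)
    (hw : ∀ t, L * ‖w t‖ ≤ M) (hγ : 0 < symmetrizationFactor N)
    (hκ : ∀ z : Fin N ⊕ Fin N → H, ∑ i, ‖z i‖ ^ 2 = 2 * N →
      ∑ σ : Fin N ⊕ Fin N → ℤˣ,
        max (‖∑ i, ((σ i : ℤ) : ℝ) • z i‖ - symmetrizationFactor N * p) 0 ≤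
      Fintype.card (Fin N ⊕ Fin N → ℤˣ) * κ) :
    ∫ S, (⨆ t, deviation φ D L ℓ p (w t) S) ∂(Measure.pi fun _ : Fin N => D) ≤
      M * κ / symmetrizationFactor N := by
  set γ := symmetrizationFactor N with hγdef
  have hcard : (0 : ℝ) < Fintype.card (Fin N ⊕ Fin N → ℤˣ) := by
    exact_mod_cast Fintype.card_pos
  have hC : ∀ (t : T) (z : 𝒳 × ℝ), |ℓ (inner ℝ (w t) (φ z.1)) z.2| ≤ b := fun t z =>
    (abs_of_nonneg (hℓ_range _ _).1).trans_le (hℓ_range _ _).2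
  have h1 := integral_ciSup_le_integral_signs D hN
    (fun t z => ℓ (inner ℝ (w t) (φ z.1)) z.2) (fun t => measurable_loss_inner hφ hℓ_meas (w t))
    hC (fun t => -(γ * p * (L * ‖w t‖)))
  have h2 : ∀ S : Fin N → 𝒳 × ℝ, (⨆ t, (-(γ * p * (L * ‖w t‖)) + symmetrizationFactor N *
      (N * (∫ z, ℓ (inner ℝ (w t) (φ z.1)) z.2 ∂D) -
        ∑ i, ℓ (inner ℝ (w t) (φ (S i).1)) (S i).2))) =
      γ * ⨆ t, deviation φ D L ℓ p (w t) S := by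
    intro S
    rw [Real.mul_iSup_of_nonneg hγ.le]
    congr 1
    ext t
    rw [deviation, populationRisk]
    ring
  simp only [h2] at h1
  rw [integral_const_mul] at h1
  have hbd : ∀ σ : Fin N ⊕ Fin N → ℤˣ, Integrable (fun z : Fin N ⊕ Fin N → 𝒳 × ℝ =>
      ⨆ t, (-(γ * p * (L * ‖w t‖)) + ∑ i, ((σ i : ℤ) : ℝ) *
        ℓ (inner ℝ (w t) (φ (z i).1)) (z i).2)) (Measure.pi fun _ => D) := by
    intro σ
    obtain ⟨Ca, hCa⟩ : ∃ Ca, ∀ t, |-(γ * p * (L * ‖w t‖))| ≤ Ca := by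
      obtain ⟨Ca, h⟩ := (Set.finite_range fun t => |-(γ * p * (L * ‖w t‖))|).bddAbove
      exact ⟨Ca, fun t => h ⟨t, rfl⟩⟩
    refine integrable_of_measurable_of_abs_le (C := Ca + ∑ _i : Fin N ⊕ Fin N, b)
      (Measurable.iSup fun t => measurable_const.add (Finset.measurable_fun_sum _ fun i _ =>
        measurable_const.mul ((measurable_loss_inner hφ hℓ_meas (w t)).comp
          (measurable_pi_apply i)))) fun z => abs_ciSup_le fun t => ?_
    refine (abs_add_le _ _).trans (add_le_add (hCa t) ((Finset.abs_sum_le_sum_abs _ _).trans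
      (Finset.sum_le_sum fun i _ => ?_)))
    rw [abs_mul]
    rcases Int.units_cast_eq_or (σ i) with h | h <;> simpa [h] using hC t (z i)
  rw [← integral_finsetSum _ fun σ _ => hbd σ] at h1
  have h3 : ∫ z : Fin N ⊕ Fin N → 𝒳 × ℝ, ∑ σ : Fin N ⊕ Fin N → ℤˣ,
      (⨆ t, (-(γ * p * (L * ‖w t‖)) + ∑ i, ((σ i : ℤ) : ℝ) *
        ℓ (inner ℝ (w t) (φ (z i).1)) (z i).2)) ∂(Measure.pi fun _ => D) ≤
      ∫ _z : Fin N ⊕ Fin N → 𝒳 × ℝ,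
        M * (Fintype.card (Fin N ⊕ Fin N → ℤˣ) * κ) ∂(Measure.pi fun _ => D) := by
    refine integral_mono_ae (integrable_finsetSum _ fun σ _ => hbd σ) (integrable_const _) ?_
    filter_upwards [ae_sum_norm_sq_sum_eq hTr] with z hz
    exact (sum_ciSup_signs_le φ hℓ_lip w hw z).trans
      (mul_le_mul_of_nonneg_left (hκ (fun i => φ (z i).1) hz) hM)
  have h4 := h1.trans h3
  simp only [integral_const, probReal_univ, one_smul] at h4
  rw [le_div_iff₀ hγ]
  refine le_of_mul_le_mul_left (le_trans (le_of_eq ?_) (h4.trans_eq ?_)) hcard <;> ring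

/-- A uniform deviation bound over all predictors of bounded norm in a separable set. -/
theorem exists_measurableSet_deviation_le [IsProbabilityMeasure D]
    (hφ : StronglyMeasurable φ) (hN : 0 < N) (hb : 0 < b)
    (hℓ_meas : Measurable (Function.uncurry ℓ)) (hℓ_lip : ∀ y, LipschitzWith L fun u => ℓ u y)
    (hℓ_range : ∀ u y, ℓ u y ∈ Set.Icc 0 b) {V : Set H} (hV : TopologicalSpace.IsSeparable V)
    (hV0 : 0 ∈ V) {M p m x : ℝ} (hM : 0 ≤ M) (hp : 0 ≤ p) (hx : 0 ≤ x)
    (hm : ∀ (n : ℕ) (w : Fin (n + 1) → H), (∀ t, L * ‖w t‖ ≤ M) →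
      ∫ S, (⨆ t, deviation φ D L ℓ p (w t) S) ∂(Measure.pi fun _ : Fin N => D) ≤
        m * (b * √N)) :
    ∃ E : Set (Fin N → 𝒳 × ℝ), MeasurableSet E ∧
      (Measure.pi fun _ : Fin N => D).real E ≤ Real.exp (-2 * x ^ 2) ∧
      ∀ S ∉ E, ∀ w ∈ V, L * ‖w‖ ≤ M → deviation φ D L ℓ p w S ≤ (m + x) * (b * √N) := by
  set μ : Measure (Fin N → 𝒳 × ℝ) := Measure.pi fun _ => D
  have hN' : (0 : ℝ) < N := by exact_mod_cast hN
  -- The dense sequence must lie in the norm ball itself, since the bound on means holds only there.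
  set W : Set H := V ∩ {w | L * ‖w‖ ≤ M}
  have hW0 : (0 : H) ∈ W := ⟨hV0, by simpa using hM⟩
  obtain ⟨t, htW, htc, hWt⟩ := (hV.mono (Set.inter_subset_left :
    W ⊆ V)).exists_countable_dense_subset
  have htne : t.Nonempty := by
    rw [← closure_nonempty_iff]; exact ⟨0, hWt hW0⟩
  obtain ⟨w, hwt⟩ := htc.exists_eq_range htne
  have hwM : ∀ n, L * ‖w n‖ ≤ M := fun n => (htW (hwt ▸ ⟨n, rfl⟩ : w n ∈ t)).2
  set g : ℕ → (Fin N → 𝒳 × ℝ) → ℝ := fun n S => ⨆ k : Fin (n + 1), deviation φ D L ℓ p (w k) S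
    with hg
  have hgm : ∀ n, Measurable (g n) := fun n =>
    Measurable.iSup fun k => measurable_deviation hφ hℓ_meas p _
  have hbdd : ∀ (n : ℕ) (S : Fin N → 𝒳 × ℝ), BddAbove (Set.range fun k : Fin (n + 1) => deviation φ D L ℓ p (w k) S) :=
    fun n S => (Set.finite_range _).bddAbove
  set E : ℕ → Set (Fin N → 𝒳 × ℝ) := fun n => {S | m * (b * √N) + x * (b * √N) ≤ g n S}
  have hEm : ∀ n, MeasurableSet (E n) := fun n => measurableSet_le measurable_const (hgm n)
  -- Failure events of growing finite classes increase, so their union keeps the common bound and no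
  -- union bound is paid.
  have hEmono : Monotone E := by
    intro n n' hnn' S hS
    have hS' : m * (b * √N) + x * (b * √N) ≤ g n S := hS
    refine hS'.trans (ciSup_le fun k => ?_)
    exact le_ciSup (hbdd n' S) (⟨k, by omega⟩ : Fin (n' + 1))
  have hEle : ∀ n, μ.real (E n) ≤ Real.exp (-2 * x ^ 2) := by
    intro n
    have h := measureReal_le_exp_of_bounded_differences D N hN hb (g n) (hgm n)
      (C := N * b + N * b + p * M)
      (fun S => abs_ciSup_le fun k => abs_deviation_le hφ hℓ_meas hℓ_range hp (hwM k) S)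
      (fun i S S' hSS' => ?_) (hm n (fun k => w k) fun k => hwM k)
      (show 0 ≤ x * (b * √N) by positivity)
    · refine h.trans (Real.exp_le_exp.2 (le_of_eq ?_))
      rw [mul_pow, mul_pow, Real.sq_sqrt hN'.le]
      field_simp
    · rw [sub_le_iff_le_add]
      refine ciSup_le fun k => ?_
      have h1 := deviation_sub_le (φ := φ) (D := D) (L := L) hℓ_range p (w k) i S S' hSS'
      have h2 := le_ciSup (hbdd n S') k
      simp only [hg]
      linarith
  refine ⟨⋃ n, E n, MeasurableSet.iUnion hEm, ?_, ?_⟩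
  · refine ENNReal.toReal_le_of_le_ofReal (Real.exp_pos _).le ?_
    rw [hEmono.measure_iUnion]
    refine iSup_le fun n => ?_
    rw [← ENNReal.ofReal_toReal (measure_ne_top μ (E n))]
    exact ENNReal.ofReal_le_ofReal (hEle n)
  · intro S hS v hvV hvM
    have hcl : IsClosed {v : H | deviation φ D L ℓ p v S ≤ (m + x) * (b * √N)} :=
      isClosed_le (continuous_deviation hφ hℓ_meas hℓ_lip hℓ_range p S) continuous_const
    refine closure_minimal (s := t) ?_ hcl (hWt ⟨hvV, hvM⟩)
    rw [hwt]
    rintro _ ⟨n, rfl⟩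
    simp only [Set.mem_iUnion, not_exists] at hS
    have h1 : g n S < m * (b * √N) + x * (b * √N) := not_le.1 (hS n)
    have h2 := le_ciSup (hbdd n S) (Fin.last n)
    simp only [Fin.val_last] at h2
    show deviation φ D L ℓ p (w n) S ≤ _
    rw [add_mul]
    exact h2.trans h1.le

end LinearPredictors

/-! ### Numerical estimates -/

theorem one_sub_div_sqrt_le_symmetrizationFactor {N : ℕ} (hN : 0 < N) :
    1 - 0.3536 / √N ≤ symmetrizationFactor N := by
  refine le_trans ?_ (le_symmetrizationFactor hN)
  have hN' : (0 : ℝ) < N := by exact_mod_cast hN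
  have hx : 0 < √(N : ℝ) := Real.sqrt_pos.2 hN'
  have h2 : √2 ≤ 1.4144 := Real.sqrt_le_iff.2 ⟨by norm_num, by norm_num⟩
  have e : √(2 * N) / (4 * N) = √2 / 4 / √N := by
    rw [Real.sqrt_mul (by norm_num)]
    nth_rewrite 2 [← Real.mul_self_sqrt hN'.le]
    field_simp
  rw [e]
  gcongr
  linarith

/-- For `x = √N` this makes the mean over small norms at most `0.68 b√N`. The range of `x` is cut at
`1.49`, `2.8` and `4.8`; on each piece `γ` is estimated at the left end and the minimum at the right
end or by `3`. -/
theorem min_half_three_le_mul_pow_four {x γ : ℝ} (hx : 1 ≤ x) (hγ : 1 - 0.3536 / x ≤ γ) :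
    81 / 512 * min (x / 2) 3 ≤ 0.68 * γ ^ 4 := by
  have key : ∀ x₁ x₂ g : ℝ, 0 < x₁ → x₁ ≤ x → min (x / 2) 3 ≤ x₂ → 0 ≤ g → g ≤ 1 - 0.3536 / x₁ →
      81 / 512 * x₂ ≤ 0.68 * g ^ 4 → 81 / 512 * min (x / 2) 3 ≤ 0.68 * γ ^ 4 := by
    intro x₁ x₂ g h0 h1 h2 hg0 hg h3
    have : g ≤ γ := by
      refine hg.trans (le_trans ?_ hγ)
      gcongr
    calc _ ≤ 81 / 512 * x₂ := by gcongr
      _ ≤ 0.68 * g ^ 4 := h3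
      _ ≤ _ := by gcongr
  rcases le_total x 1.49 with h | h
  · exact key 1 0.745 0.6464 (by norm_num) hx ((min_le_left _ _).trans (by linarith))
      (by norm_num) (by norm_num) (by norm_num)
  rcases le_total x 2.8 with h' | h'
  · exact key 1.49 1.4 0.762 (by norm_num) h ((min_le_left _ _).trans (by linarith))
      (by norm_num) (by norm_num) (by norm_num)
  rcases le_total x 4.8 with h'' | h''
  · exact key 2.8 2.4 0.873 (by norm_num) h' ((min_le_left _ _).trans (by linarith))
      (by norm_num) (by norm_num) (by norm_num)
  · exact key 4.8 3 0.926 (by norm_num) h'' (min_le_right _ _)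
      (by norm_num) (by norm_num) (by norm_num)

/-- The total failure probability: small norms, then shells. Relative to `exp(-2s²/9)` the first
term contributes at most `1.131` and the geometric shell tail at most `0.0292`, below `2/(e-1) ≈
1.164`. -/
theorem sum_exp_neg_sq_le {s : ℝ} (hs : 0.79 ≤ s) (N : ℕ) :
    Real.exp (-2 * (s - 0.68) ^ 2) +
      ∑ j ∈ Finset.range N, Real.exp (-2 * (s + 0.7 + 0.24 * j) ^ 2) ≤
    2 / (Real.exp 1 - 1) * Real.exp (-(2 * s ^ 2 / 9)) := by
  set q := Real.exp (-1) with hq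
  have he1 := Real.exp_one_gt_d9
  have he2 := Real.exp_one_lt_d9
  have hq0 : 0 < q := Real.exp_pos _
  have hq1 : q ≤ 0.368 := by
    rw [hq, Real.exp_neg, inv_le_comm₀ (Real.exp_pos _) (by norm_num)]
    norm_num at he1 ⊢
    linarith
  have h1 : Real.exp (-2 * (s - 0.68) ^ 2) ≤
      Real.exp (-(2 * s ^ 2 / 9)) * Real.exp 0.1156 := by
    rw [← Real.exp_add, Real.exp_le_exp]
    -- The exponent difference is a concave quadratic in `s` with maximum `0.1156` at `s = 0.765`.
    nlinarith [sq_nonneg (s - 0.765)]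
  have h2 : Real.exp 0.1156 ≤ 1.131 := by
    have h := Real.one_sub_le_exp_neg 0.1156
    rw [Real.exp_neg, le_inv_comm₀ (by norm_num) (Real.exp_pos _)] at h
    exact h.trans (by norm_num)
  have h3 : ∀ j ∈ Finset.range N, Real.exp (-2 * (s + 0.7 + 0.24 * j) ^ 2) ≤
      Real.exp (-(2 * s ^ 2 / 9)) * q ^ 4 * q ^ j := by
    intro j _
    rw [hq, ← Real.exp_nat_mul, ← Real.exp_nat_mul, ← Real.exp_add, ← Real.exp_add,
      Real.exp_le_exp]
    have hj : (0 : ℝ) ≤ j := Nat.cast_nonneg _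
    push_cast
    nlinarith [mul_nonneg hj (sub_nonneg.2 hs), mul_nonneg hj hj,
      mul_nonneg (sub_nonneg.2 hs) (sub_nonneg.2 hs)]
  have h4 : ∑ j ∈ Finset.range N, q ^ j ≤ 1 / (1 - q) := by
    rw [le_div_iff₀ (by linarith), geom_sum_mul_neg]
    linarith [pow_pos hq0 N]
  have h5 : q ^ 4 * (1 / (1 - q)) ≤ 0.0292 := by
    rw [mul_one_div, div_le_iff₀ (by linarith)]
    have : q ^ 4 ≤ 0.368 ^ 4 := by gcongr
    norm_num at this ⊢
    linarith
  have h6 : 1.1603 ≤ 2 / (Real.exp 1 - 1) := by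
    rw [le_div_iff₀ (by linarith)]
    norm_num at he2 ⊢
    linarith
  have hE := Real.exp_pos (-(2 * s ^ 2 / 9))
  calc _ ≤ Real.exp (-(2 * s ^ 2 / 9)) * 1.131 +
        Real.exp (-(2 * s ^ 2 / 9)) * q ^ 4 * ∑ j ∈ Finset.range N, q ^ j := by
        rw [Finset.mul_sum]
        refine add_le_add (h1.trans ?_) (Finset.sum_le_sum h3)
        gcongr
    _ ≤ Real.exp (-(2 * s ^ 2 / 9)) * 1.131 + Real.exp (-(2 * s ^ 2 / 9)) * 0.0292 := by
        rw [mul_assoc]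
        gcongr
        exact le_trans (by gcongr) h5
    _ ≤ 1.1603 * Real.exp (-(2 * s ^ 2 / 9)) := by linarith
    _ ≤ _ := by gcongr

/-! ### The norm of the kernel solution -/

section KernelSolution

variable {𝒳 H : Type*} [NormedAddCommGroup H] [InnerProductSpace ℝ H]

theorem trace_kernelMatrix (φ : 𝒳 → H) {N : ℕ} (S : Fin N → 𝒳 × ℝ) :
    (kernelMatrix φ S).trace = ∑ i, ‖φ (S i).1‖ ^ 2 := by
  simp [kernelMatrix, Matrix.trace, Matrix.gram_apply]

theorem kernelSolution_mem_span (φ : 𝒳 → H) {N : ℕ} (S : Fin N → 𝒳 × ℝ) :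
    kernelSolution φ S ∈ Submodule.span ℝ (Set.range φ) :=
  Submodule.smul_mem _ _ (Submodule.sum_mem _ fun _ _ =>
    Submodule.smul_mem _ _ (Submodule.subset_span ⟨_, rfl⟩))

theorem norm_sq_kernelSolution (φ : 𝒳 → H) {N : ℕ} (hN : 0 < N) (S : Fin N → 𝒳 × ℝ)
    (hTr : (kernelMatrix φ S).trace = N) (hK : IsUnit (kernelMatrix φ S)) :
    ‖kernelSolution φ S‖ ^ 2 = targets S ⬝ᵥ (kernelMatrix φ S)⁻¹ *ᵥ targets S := by
  have hN' : (N : ℝ) ≠ 0 := by exact_mod_cast hN.ne'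
  have hdet : IsUnit (kernelMatrix φ S).det := (Matrix.isUnit_iff_isUnit_det _).1 hK
  rw [kernelSolution, hTr, div_self hN', Real.sqrt_one, one_smul]
  set α := (kernelMatrix φ S)⁻¹ *ᵥ targets S with hα
  have h1 : kernelMatrix φ S *ᵥ α = targets S := by
    rw [hα, Matrix.mulVec_mulVec, Matrix.mul_nonsing_inv _ hdet, Matrix.one_mulVec]
  have h2 := Matrix.star_dotProduct_gram_mulVec (𝕜 := ℝ) (fun i => φ (S i).1) α α
  rw [← real_inner_self_eq_norm_sq, ← h2, star_trivial]
  change α ⬝ᵥ (kernelMatrix φ S *ᵥ α) = _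
  rw [h1, dotProduct_comm]

end KernelSolution

/-! ### Uniform bound over small norms and shells -/

section UniformBound

variable {𝒳 H : Type*} [MeasurableSpace 𝒳] [NormedAddCommGroup H] [InnerProductSpace ℝ H]
  {φ : 𝒳 → H} {D : Measure (𝒳 × ℝ)} [IsProbabilityMeasure D] {N : ℕ} {L : ℝ≥0} {b : ℝ}
  {ℓ : ℝ → ℝ → ℝ}

/-- The predictors whose norm is at most a constant multiple of `b / L`. -/
theorem exists_measurableSet_deviation_le_of_small_norm (hφ : StronglyMeasurable φ) (hN : 0 < N)
    (hTr : ∀ᵐ S ∂(Measure.pi fun _ : Fin N => D), ∑ i, ‖φ (S i).1‖ ^ 2 = N) (hb : 0 < b)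
    (hℓ_meas : Measurable (Function.uncurry ℓ)) (hℓ_lip : ∀ y, LipschitzWith L fun u => ℓ u y)
    (hℓ_range : ∀ u y, ℓ u y ∈ Set.Icc 0 b) {V : Set H} (hV : TopologicalSpace.IsSeparable V)
    (hV0 : 0 ∈ V) {x : ℝ} (hx : 0 ≤ x) :
    ∃ E : Set (Fin N → 𝒳 × ℝ), MeasurableSet E ∧
      (Measure.pi fun _ : Fin N => D).real E ≤ Real.exp (-2 * x ^ 2) ∧
      ∀ S ∉ E, ∀ w ∈ V, L * ‖w‖ ≤ min (√N / 2) 3 * b →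
        deviation φ D L ℓ (2 * √N) w S ≤ (0.68 + x) * (b * √N) := by
  have hN' : (0 : ℝ) < N := by exact_mod_cast hN
  have hs : 0 < √(N : ℝ) := Real.sqrt_pos.2 hN'
  have hs1 : (1 : ℝ) ≤ √(N : ℝ) := Real.one_le_sqrt.2 (by exact_mod_cast hN)
  have hγ := one_sub_div_sqrt_le_symmetrizationFactor hN
  have hγ0 : 0 < symmetrizationFactor N := by
    refine lt_of_lt_of_le ?_ hγ
    rw [sub_pos, div_lt_one hs]
    exact lt_of_lt_of_le (by norm_num) hs1
  have hM : 0 ≤ min (√(N : ℝ) / 2) 3 * b := mul_nonneg (le_min (by positivity) (by norm_num)) hb.le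
  refine exists_measurableSet_deviation_le hφ hN hb hℓ_meas hℓ_lip hℓ_range hV hV0 hM
    (by positivity) hx fun n w hw => ?_
  refine (integral_ciSup_deviation_le (φ := φ) (b := b)
    (κ := 81 / 256 * (2 * N) ^ 2 / (symmetrizationFactor N * (2 * √N)) ^ 3) hφ hN hTr hℓ_meas
    hℓ_lip hℓ_range w hM hw hγ0 fun z hz => ?_).trans ?_
  · rw [← hz]
    exact sum_max_norm_sum_sub_le z (by positivity)
  · have h := min_half_three_le_mul_pow_four hs1 hγ
    set γ := symmetrizationFactor N
    set y := √(N : ℝ) with hy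
    have hNy : (N : ℝ) = y ^ 2 := (Real.sq_sqrt hN'.le).symm
    rw [hNy]
    have e : min (y / 2) 3 * b * (81 / 256 * (2 * y ^ 2) ^ 2 / (γ * (2 * y)) ^ 3) / γ =
        81 / 512 * min (y / 2) 3 * (b * y) / γ ^ 4 := by
      field_simp
      ring
    rw [e, div_le_iff₀ (by positivity)]
    calc _ ≤ 0.68 * γ ^ 4 * (b * y) := by gcongr
      _ = _ := by ring

/-- Without penalty the first moment gives the mean `√2 ρ/γ` in units of `b√N`; for `N ≥ 36` one has
`γ ≥ 0.94`, hence `1.51`. -/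
theorem exists_measurableSet_deviation_le_of_large_norm (hφ : StronglyMeasurable φ) (hN : 36 ≤ N)
    (hTr : ∀ᵐ S ∂(Measure.pi fun _ : Fin N => D), ∑ i, ‖φ (S i).1‖ ^ 2 = N) (hb : 0 < b)
    (hℓ_meas : Measurable (Function.uncurry ℓ)) (hℓ_lip : ∀ y, LipschitzWith L fun u => ℓ u y)
    (hℓ_range : ∀ u y, ℓ u y ∈ Set.Icc 0 b) {V : Set H} (hV : TopologicalSpace.IsSeparable V)
    (hV0 : 0 ∈ V) {x ρ : ℝ} (hx : 0 ≤ x) (hρ : 0 ≤ ρ) :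
    ∃ E : Set (Fin N → 𝒳 × ℝ), MeasurableSet E ∧
      (Measure.pi fun _ : Fin N => D).real E ≤ Real.exp (-2 * x ^ 2) ∧
      ∀ S ∉ E, ∀ w ∈ V, L * ‖w‖ ≤ ρ * b →
        deviation φ D L ℓ 0 w S ≤ (1.51 * ρ + x) * (b * √N) := by
  have hN0 : 0 < N := by omega
  have hN' : (0 : ℝ) < N := by exact_mod_cast hN0
  have hs : 6 ≤ √(N : ℝ) := Real.le_sqrt_of_sq_le (by norm_num; exact_mod_cast hN)
  have hγ := one_sub_div_sqrt_le_symmetrizationFactor hN0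
  have hγ1 : 0.94 ≤ symmetrizationFactor N := by
    refine le_trans ?_ hγ
    rw [le_sub_comm, div_le_iff₀ (by linarith)]
    norm_num at hs ⊢
    linarith
  have hγ0 : 0 < symmetrizationFactor N := lt_of_lt_of_le (by norm_num) hγ1
  refine exists_measurableSet_deviation_le hφ hN0 hb hℓ_meas hℓ_lip hℓ_range hV hV0
    (mul_nonneg hρ hb.le) le_rfl hx fun n w hw => ?_
  refine (integral_ciSup_deviation_le (φ := φ) (b := b) (κ := √(2 * N)) hφ hN0 hTr hℓ_meas hℓ_lip
    hℓ_range w (mul_nonneg hρ hb.le) hw hγ0 fun z hz => ?_).trans ?_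
  · have := sum_norm_sum_le z
    rw [hz] at this
    simpa using this
  · have h2 : √2 ≤ 1.4143 := Real.sqrt_le_iff.2 ⟨by norm_num, by norm_num⟩
    rw [div_le_iff₀ hγ0, Real.sqrt_mul (by norm_num)]
    have h3 : √2 ≤ 1.51 * symmetrizationFactor N := by
      norm_num at h2 hγ1 ⊢
      linarith
    calc ρ * b * (√2 * √N) = √2 * (ρ * b * √N) := by ring
      _ ≤ 1.51 * symmetrizationFactor N * (ρ * b * √N) := by gcongr
      _ = _ := by ring

/-- A uniform generalization bound for linear predictors with Lipschitz losses. -/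
theorem exists_measurableSet_risk_sub_le (hφ : StronglyMeasurable φ) (hN : 0 < N)
    (hTr : ∀ᵐ S ∂(Measure.pi fun _ : Fin N => D), ∑ i, ‖φ (S i).1‖ ^ 2 = N) (hb : 0 < b)
    (hℓ_meas : Measurable (Function.uncurry ℓ)) (hℓ_lip : ∀ y, LipschitzWith L fun u => ℓ u y)
    (hℓ_range : ∀ u y, ℓ u y ∈ Set.Icc 0 b) {V : Set H} (hV : TopologicalSpace.IsSeparable V)
    (hV0 : 0 ∈ V) {s : ℝ} (hs : 0.79 ≤ s) :
    ∃ E : Set (Fin N → 𝒳 × ℝ), MeasurableSet E ∧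
      (Measure.pi fun _ : Fin N => D).real E ≤
        2 / (Real.exp 1 - 1) * Real.exp (-(2 * s ^ 2 / 9)) ∧
      ∀ S ∉ E, ∀ w ∈ V, N * populationRisk D φ ℓ w - ∑ i, ℓ (inner ℝ w (φ (S i).1)) (S i).2 ≤
        2 * √N * (L * ‖w‖) + s * (b * √N) := by
  have hN' : (0 : ℝ) < N := by exact_mod_cast hN
  have hsN : 0 < √(N : ℝ) := Real.sqrt_pos.2 hN'
  have hs0 : 0 ≤ s := by linarith
  have htriv : ∀ (S : Fin N → 𝒳 × ℝ) (w : H), √N * b ≤ 2 * (L * ‖w‖) →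
      N * populationRisk D φ ℓ w - ∑ i, ℓ (inner ℝ w (φ (S i).1)) (S i).2 ≤
        2 * √N * (L * ‖w‖) + s * (b * √N) := by
    intro S w hw
    have h1 := (populationRisk_mem_Icc (D := D) hφ hℓ_meas hℓ_range w).2
    have h2 : 0 ≤ ∑ i, ℓ (inner ℝ w (φ (S i).1)) (S i).2 :=
      Finset.sum_nonneg fun i _ => (hℓ_range _ _).1
    have h3 : N * populationRisk D φ ℓ w ≤ N * b := by gcongr
    have h4 : √N * (√N * b) ≤ √N * (2 * (L * ‖w‖)) := by gcongr
    rw [← mul_assoc, Real.mul_self_sqrt hN'.le] at h4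
    have h5 : 0 ≤ s * (b * √N) := by positivity
    linarith
  obtain ⟨E₀, hE₀m, hE₀, hE₀'⟩ := exists_measurableSet_deviation_le_of_small_norm hφ hN hTr hb
    hℓ_meas hℓ_lip hℓ_range hV hV0 (x := s - 0.68) (by norm_num at hs ⊢; linarith)
  have hsmall : ∀ S ∉ E₀, ∀ w ∈ V, L * ‖w‖ ≤ min (√N / 2) 3 * b →
      N * populationRisk D φ ℓ w - ∑ i, ℓ (inner ℝ w (φ (S i).1)) (S i).2 ≤
        2 * √N * (L * ‖w‖) + s * (b * √N) := by
    intro S hS w hw hwM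
    have := hE₀' S hS w hw hwM
    rw [deviation, add_sub_cancel] at this
    linarith
  have hsum := sum_exp_neg_sq_le hs N
  by_cases h36 : 36 ≤ N
  -- Shell `j` covers `3 + j/2 ≤ L‖w‖/b ≤ 3 + (j+1)/2`. Its level exceeds `s` by `0.7 + 0.24 j`, an
  -- amount chosen to fit in the slack between `1.51` and `2`.
  · have hshell := fun j : ℕ => exists_measurableSet_deviation_le_of_large_norm hφ h36 hTr hb
      hℓ_meas hℓ_lip hℓ_range hV hV0 (x := s + 0.7 + 0.24 * j) (ρ := 3 + (j + 1) / 2)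
      (by positivity) (by positivity)
    choose E hEm hE hE' using hshell
    refine ⟨E₀ ∪ ⋃ j ∈ Finset.range N, E j,
      hE₀m.union (Finset.measurableSet_biUnion _ fun j _ => hEm j), ?_, ?_⟩
    · refine (measureReal_union_le _ _).trans (le_trans (add_le_add hE₀ ?_) hsum)
      exact (measureReal_biUnion_finset_le _ _).trans (Finset.sum_le_sum fun j _ => hE j)
    · intro S hS w hw
      simp only [Set.mem_union, Set.mem_iUnion, not_or, not_exists] at hS
      by_cases h1 : √N * b ≤ 2 * (L * ‖w‖)
      · exact htriv S w h1
      by_cases h2 : L * ‖w‖ ≤ 3 * b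
      · refine hsmall S hS.1 w hw ?_
        rcases min_choice (√(N : ℝ) / 2) 3 with h | h <;> rw [h]
        · linarith
        · exact h2
      push Not at h1 h2
      set ρ := L * ‖w‖ / b with hρ
      have hρb : L * ‖w‖ = ρ * b := by rw [hρ]; field_simp
      have hρ3 : 3 < ρ := by rw [hρ, lt_div_iff₀ hb]; exact h2
      have hρN : 2 * ρ < √N := by
        rw [hρb] at h1
        nlinarith
      -- Nontrivial norms have `2ρ < √N ≤ N`, so `N` shells suffice.
      have hsqrtN : √(N : ℝ) ≤ N := by
        rw [Real.sqrt_le_left hN'.le]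
        have : (1 : ℝ) ≤ N := by exact_mod_cast hN
        nlinarith
      set j := ⌊2 * (ρ - 3)⌋₊ with hj
      have hj1 : (j : ℝ) ≤ 2 * (ρ - 3) := Nat.floor_le (by linarith)
      have hj2 : 2 * (ρ - 3) < j + 1 := Nat.lt_floor_add_one _
      have hjN : j < N := by
        have : (j : ℝ) < N := by linarith
        exact_mod_cast this
      have h3 := hE' j S (hS.2 j (Finset.mem_range.2 hjN)) w hw (by
        rw [hρb]
        gcongr
        linarith)
      rw [deviation, zero_mul, sub_zero] at h3
      refine h3.trans ?_
      rw [hρb]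
      have h4 : 1.51 * (3 + ((j : ℝ) + 1) / 2) + (s + 0.7 + 0.24 * j) ≤ 2 * ρ + s := by
        have : (0 : ℝ) ≤ j := Nat.cast_nonneg _
        norm_num
        linarith
      calc _ ≤ (2 * ρ + s) * (b * √N) := by gcongr
        _ = _ := by ring
  -- For `N < 36`, `√N/2 ≤ 3`: every norm is either small or trivial, and no shell is needed.
  · refine ⟨E₀, hE₀m, hE₀.trans (le_trans (le_add_of_nonneg_right
      (Finset.sum_nonneg fun j _ => (Real.exp_pos _).le)) hsum), fun S hS w hw => ?_⟩
    by_cases h1 : √N * b ≤ 2 * (L * ‖w‖)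
    · exact htriv S w h1
    · refine hsmall S hS w hw ?_
      have : √(N : ℝ) ≤ 6 := Real.sqrt_le_iff.2 ⟨by norm_num, by
        norm_num; exact_mod_cast (by omega : N ≤ 36)⟩
      rw [min_eq_left (by linarith)]
      linarith

end UniformBound

/-! ### The generalization bound -/

theorem mainTheorem6 {𝒳 H : Type*} [MeasurableSpace 𝒳]
    [NormedAddCommGroup H] [InnerProductSpace ℝ H] [CompleteSpace H]
    (φ : 𝒳 → H) (hφ : StronglyMeasurable φ)
    (D : Measure (𝒳 × ℝ)) [IsProbabilityMeasure D]
    (N : ℕ) (hN : 0 < N)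
    (hTr : ∀ᵐ S ∂(Measure.pi fun _ : Fin N => D), (kernelMatrix φ S).trace = N)
    (L : ℝ≥0) (b : ℝ) (ℓ : ℝ → ℝ → ℝ)
    (hℓ_meas : Measurable (Function.uncurry ℓ))
    (hℓ_lip : ∀ y, LipschitzWith L fun u => ℓ u y)
    (hℓ_range : ∀ u y, ℓ u y ∈ Set.Icc 0 b)
    (δ : ℝ) (hδ : 0 < δ) :
    1 - δ ≤ (Measure.pi fun _ : Fin N => D).real
      {S | IsUnit (kernelMatrix φ S) →
        populationRisk D φ ℓ (kernelSolution φ S) - empiricalRisk φ ℓ S (kernelSolution φ S) ≤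
          (2 * √2 * L + 3 * b) / √2 *
              (√((kernelMatrix φ S).trace *
                (targets S ⬝ᵥ (kernelMatrix φ S)⁻¹ *ᵥ targets S)) / N) +
            3 * b * √(Real.log (2 / (δ * (Real.exp 1 - 1))) / (2 * N))} := by
  classical
  have hN' : (0 : ℝ) < N := by exact_mod_cast hN
  set μ : Measure (Fin N → 𝒳 × ℝ) := Measure.pi fun _ => D
  rcases le_or_gt 1 δ with hδ1 | hδ1
  · exact le_trans (by linarith) measureReal_nonneg
  have he1 := Real.exp_one_gt_d9
  have he2 := Real.exp_one_lt_d9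
  set Λ := Real.log (2 / (δ * (Real.exp 1 - 1))) with hΛ
  have harg : 0 < 2 / (δ * (Real.exp 1 - 1)) := by
    have : 0 < Real.exp 1 - 1 := by linarith
    positivity
  have hb0 : 0 ≤ b := (hℓ_range 0 0).1.trans (hℓ_range 0 0).2
  rcases hb0.eq_or_lt with hb | hb
  -- Norms are measured in units of `b` below, so `b = 0` is set apart; the loss then vanishes.
  · have hℓ0 : ∀ u y, ℓ u y = 0 := fun u y =>
      le_antisymm ((hℓ_range u y).2.trans_eq hb.symm) (hℓ_range u y).1
    refine le_trans (by linarith) (ge_of_eq ((congrArg μ.real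
      (Set.eq_univ_of_forall fun S hS => ?_)).trans probReal_univ))
    have h0 : populationRisk D φ ℓ (kernelSolution φ S) -
        empiricalRisk φ ℓ S (kernelSolution φ S) = 0 := by
      simp [populationRisk, empiricalRisk, hℓ0]
    rw [h0]
    positivity
  set s := 3 * √(Λ / 2) with hs
  -- As `δ < 1`, `Λ` exceeds `log (2/(e-1)) > 0`; this keeps `s` above `0.79`, where the numerical
  -- estimates hold.
  have hΛ1 : 0.1408 ≤ Λ := by
    refine le_trans ?_ (Real.one_sub_inv_le_log_of_pos harg)
    rw [inv_div]
    have : δ * (Real.exp 1 - 1) ≤ 1 * (Real.exp 1 - 1) := by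
      gcongr
      linarith
    norm_num at he2 ⊢
    linarith
  have hΛ0 : 0 ≤ Λ := le_trans (by norm_num) hΛ1
  have hs1 : 0.79 ≤ s := by
    have : 0.79 / 3 ≤ √(Λ / 2) := Real.le_sqrt_of_sq_le (by
      norm_num at hΛ1 ⊢
      linarith)
    rw [hs]
    norm_num at this ⊢
    linarith
  have hδe : 2 / (Real.exp 1 - 1) * Real.exp (-(2 * s ^ 2 / 9)) = δ := by
    have : 2 * s ^ 2 / 9 = Λ := by
      rw [hs, mul_pow, Real.sq_sqrt (by positivity)]
      ring
    have he : Real.exp 1 - 1 ≠ 0 := by linarith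
    rw [this, Real.exp_neg, hΛ, Real.exp_log harg]
    field_simp
  -- `H` need not be separable, but strong measurability makes the range of `φ` separable, and `w`
  -- lies in its span.
  have hV : TopologicalSpace.IsSeparable (Submodule.span ℝ (Set.range φ) : Set H) :=
    hφ.isSeparable_range.span
  have hTr' : ∀ᵐ S ∂μ, ∑ i, ‖φ (S i).1‖ ^ 2 = N := by
    filter_upwards [hTr] with S hS
    rw [← hS, trace_kernelMatrix]
  obtain ⟨E, hEm, hE, hE'⟩ := exists_measurableSet_risk_sub_le hφ hN hTr' hb hℓ_meas hℓ_lip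
    hℓ_range hV (Submodule.zero_mem _) hs1
  rw [hδe] at hE
  have h1 : 1 - δ ≤ μ.real Eᶜ := by
    rw [probReal_compl_eq_one_sub hEm]
    linarith
  -- Only `E` is known to be measurable; the target event contains its complement up to a null set.
  refine h1.trans (ENNReal.toReal_mono (measure_ne_top _ _) (measure_mono_ae ?_))
  filter_upwards [hTr] with S hS hSE hK
  have hw := hE' S hSE (kernelSolution φ S) (kernelSolution_mem_span φ S)
  rw [hS, ← norm_sq_kernelSolution φ hN S hS hK, empiricalRisk]
  set w := kernelSolution φ S
  rw [Real.sqrt_mul hN'.le, Real.sqrt_sq (norm_nonneg _)]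
  have h2 : 2 * (L : ℝ) ≤ (2 * √2 * L + 3 * b) / √2 := by
    rw [le_div_iff₀ (by positivity)]
    nlinarith
  have h3 : 3 * b * √(Λ / (2 * N)) = s * (b * √N) / N := by
    rw [hs, show Λ / (2 * N) = Λ / 2 / N by field_simp, Real.sqrt_div (by positivity)]
    nth_rewrite 3 [← Real.mul_self_sqrt hN'.le]
    field_simp
  rw [h3]
  calc _ = (N * populationRisk D φ ℓ w - ∑ i, ℓ (inner ℝ w (φ (S i).1)) (S i).2) / N := by
        field_simp
    _ ≤ (2 * √N * (L * ‖w‖) + s * (b * √N)) / N := by gcongr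
    _ = 2 * L * (√N * ‖w‖ / N) + s * (b * √N) / N := by ring
    _ ≤ _ := by gcongr
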